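/- Let $A_0$ be a Dedekind domain with fraction field $K_0$, let $Z$ be the set of closed points of $Y=\operatorname{Spec}A_0$ (the nonzero primes), and let $\operatorname{ord}_z$ be the valuation of $K_0$ at $z\in Z$. Let $N$ be a lattice (free abelian group of finite rank), $M=\operatorname{Hom}(N,\mathbb Z)$, $N_{\mathbb Q}=\mathbb Q\otimes N$, $M_{\mathbb Q}$ the dual of $N_{\mathbb Q}$, and $K_0[M]=\bigoplus_{m\in M}K_0\chi^m$ the group algebra. A pointed polyhedral cone is a finitely generated cone that contains no line; $\sigma^\vee\subset M_{\mathbb Q}$ denotes the dual of a cone $\sigma\subset N_{\mathbb Q}$. For a pointed polyhedral cone $\sigma\subset N_{\mathbb Q}$, a $\sigma$-polyhedron is a set $\Delta=Q+\sigma\subset N_{\mathbb Q}$ with $Q$ a nonempty polytope. A $\sigma$-polyhedral divisor over $A_0$ is a formal sum $\mathfrak D=\sum_{z\in Z}\Delta_z\cdot z$ of $\sigma$-polyhedra $\Delta_z$ with $\Delta_z=\sigma$ for all but finitely many $z$. For $m\in\sigma^\vee$ put $\mathfrak D(m)=\sum_z h_{\Delta_z}(m)\cdot z$ with $h_{\Delta_z}(m)=\min_{v\in\Delta_z}\langle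 m,v\rangle\in\mathbb Q$, and let $$A_0[\mathfrak D]=\bigoplus_{m\in\sigma^\vee\cap M}H^0\bigl(Y,\mathcal O_Y(\lfloor\mathfrak D(m)\rfloor)\bigr)\chi^m\subset K_0[M],$$ where $H^0(Y,\mathcal O_Y(D))=\{0\}\cup\{f\in K_0^*: \operatorname{ord}_z f+D_z\ge 0 \text{ for all } z\in Z\}$ for an integral divisor $D=\sum_z D_z\cdot z$. (i) Let $\sigma\subset N_{\mathbb Q}$ be a pointed polyhedral cone. For every $\sigma$-polyhedral divisor $\mathfrak D$ over $A_0$, the algebra $A_0[\mathfrak D]$ is normal and noetherian, and has the same fraction field as $K_0[M]$. (ii) Let $\sigma\subset N_{\mathbb Q}$ be a pointed polyhedral cone, and let $A=\bigoplus_{m}A_m\chi^m\subset K_0[M]$, with $A_m\subset K_0$, be a normal noetherian $M$-graded $A_0$-subalgebra whose graded piece of degree $0\in M$ is $A_0$, whose weight cone (the cone generated by the $m$ with $A_m\neq 0$) is $\sigma^\vee$, and which has the same fraction field as $K_0[M]$. Then there is a unique $\sigma$-polyhedral divisor $\mathfrak D$ over $A_0$ with $A=A_0[\mathfrak D]$.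 (iii) Let $f_1,\dots,f_r\in K_0^*$ and let $m_1,\dots,m_r\in M$ be nonzero vectors that generate the lattice $M$. Let $\sigma\subset N_{\mathbb Q}$ be the dual of the cone generated by $m_1,\dots,m_r$. Then $\sigma$ is a pointed polyhedral cone, $\sigma^\vee$ is generated by $m_1,\dots,m_r$, and the algebra $A=A_0[f_1\chi^{m_1},\dots,f_r\chi^{m_r}]$ has the same fraction field as $K_0[M]$. For $z\in Z$ put $$\Delta_z[f]=\{v\in N_{\mathbb Q}:\langle m_i,v\rangle\ge-\operatorname{ord}_z f_i,\ i=1,\dots,r\},$$ and suppose that $\Delta_z[f]\ne\emptyset$ for every $z\in Z$. Then $\mathfrak D[f]=\sum_z\Delta_z[f]\cdot z$ is a $\sigma$-polyhedral divisor, and the normalization of $A$ (its integral closure in its fraction field) is $A_0[\mathfrak D[f]]$. -/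

import Mathlib

open scoped Pointwise TensorProduct

/-- The rational vector space `N_ℚ = ℚ ⊗ N` of a lattice `N`. -/
abbrev RatSpace (N : Type*) [AddCommGroup N] : Type _ := ℚ ⊗[ℤ] N

/-- The lattice `M = Hom(N, ℤ)` dual to `N`. -/
abbrev DualLattice (N : Type*) [AddCommGroup N] : Type _ := Module.Dual ℤ N

/-- The dual `M_ℚ` of the rational vector space `N_ℚ`. -/
abbrev DualRatSpace (N : Type*) [AddCommGroup N] : Type _ := Module.Dual ℚ (RatSpace N)

/-- The inclusion `M → M_ℚ`; it sends `m` to the linear form `⟨m, ·⟩` on `N_ℚ`. -/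
noncomputable def toDualRat {N : Type*} [AddCommGroup N] :
    DualLattice N →ₗ[ℤ] DualRatSpace N :=
  Module.Dual.baseChange ℚ

theorem toDualRat_tmul {N : Type*} [AddCommGroup N] (m : DualLattice N) (q : ℚ) (n : N) :
    toDualRat m (q ⊗ₜ[ℤ] n) = q * (m n : ℚ) := by
  simp [toDualRat, mul_comm]

/-- The dual cone `σ^∨ ⊆ M_ℚ` of a cone `σ ⊆ N_ℚ`. -/
noncomputable def dualCone {N : Type*} [AddCommGroup N] (σ : PointedCone ℚ (RatSpace N)) :
    PointedCone ℚ (DualRatSpace N) :=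
  PointedCone.dual (Module.Dual.eval ℚ (RatSpace N)) (σ : Set (RatSpace N))

theorem mem_dualCone {N : Type*} [AddCommGroup N] {σ : PointedCone ℚ (RatSpace N)}
    {u : DualRatSpace N} : u ∈ dualCone σ ↔ ∀ v ∈ σ, 0 ≤ u v := Iff.rfl

/-- A polyhedral cone (generated by finitely many vectors) which contains no line. -/
def IsPointedPolyhedralCone {N : Type*} [AddCommGroup N] (σ : PointedCone ℚ (RatSpace N)) :
    Prop :=
  σ.FG ∧ (σ : ConvexCone ℚ (RatSpace N)).Salient

/-- `Δ` is a `σ`-polyhedron: the Minkowski sum of a (nonempty) polytope and of the cone `σ`. -/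
def IsSigmaPolyhedron {N : Type*} [AddCommGroup N] (σ : PointedCone ℚ (RatSpace N))
    (Δ : Set (RatSpace N)) : Prop :=
  ∃ Q : Set (RatSpace N), Q.Finite ∧ Q.Nonempty ∧
    Δ = convexHull ℚ Q + (σ : Set (RatSpace N))

/-- A linear form in `σ^∨` attains its minimum on a `σ`-polyhedron. -/
theorem IsSigmaPolyhedron.exists_isLeast {N : Type*} [AddCommGroup N]
    {σ : PointedCone ℚ (RatSpace N)} {Δ : Set (RatSpace N)} (h : IsSigmaPolyhedron σ Δ)
    {u : DualRatSpace N} (hu : u ∈ dualCone σ) : ∃ c : ℚ, IsLeast (u '' Δ) c := by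
  obtain ⟨Q, hQ, hne, rfl⟩ := h
  obtain ⟨q, hq, hmin⟩ := Set.exists_min_image Q u hQ hne
  refine ⟨u q, ⟨q, ⟨q, subset_convexHull ℚ Q hq, 0, σ.zero_mem, add_zero q⟩, rfl⟩, ?_⟩
  rintro _ ⟨_, ⟨x, hx, s, hs, rfl⟩, rfl⟩
  have hx' : x ∈ {y : RatSpace N | u q ≤ u y} :=
    convexHull_min (fun y hy => hmin y hy) (convex_halfSpace_ge u.isLinear (u q)) hx
  have hs' : 0 ≤ u s := mem_dualCone.1 hu s hs
  have hx'' : u q ≤ u x := hx'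
  simp only [map_add]
  linarith

section Dedekind

variable {A₀ : Type*} [CommRing A₀] [IsDedekindDomain A₀]
  {K : Type*} [Field K] [Algebra A₀ K] [IsFractionRing A₀ K]

/-- The order of vanishing `ord_z f` of `f ∈ K₀` at the closed point `z` of `Spec A₀`
(meaningful for `f ≠ 0` only). The valuation in Mathlib is multiplicative: it sends `f ≠ 0`
to `exp (-ord_z f)`. -/
noncomputable def ordAt (z : IsDedekindDomain.HeightOneSpectrum A₀) (f : K) : ℤ :=
  -WithZero.log (z.valuation K f)

theorem neg_le_ordAt_iff (z : IsDedekindDomain.HeightOneSpectrum A₀) {f : K} (hf : f ≠ 0)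
    (n : ℤ) : -n ≤ ordAt z f ↔ z.valuation K f ≤ WithZero.exp n := by
  rw [ordAt, neg_le_neg_iff, WithZero.log_le_iff_le_exp]
  simpa using hf

variable (K) in
/-- The global sections `H⁰(Y, O_Y(D))` of an integral Weil divisor `D` on `Y = Spec A₀`:
zero, and the `f ∈ K₀^*` with `div f + D ≥ 0`. -/
noncomputable def globalSections (D : IsDedekindDomain.HeightOneSpectrum A₀ →₀ ℤ) :
    Submodule A₀ K where
  carrier := {f | f ≠ 0 → ∀ z, 0 ≤ ordAt z f + D z}
  zero_mem' := fun h => absurd rfl h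
  add_mem' := by
    intro f g hf hg hfg z
    have key : ∀ x : K, (x ≠ 0 → ∀ z, 0 ≤ ordAt z x + D z) →
        z.valuation K x ≤ WithZero.exp (D z) := by
      intro x hx
      by_cases h0 : x = 0
      · simp [h0]
      · exact (neg_le_ordAt_iff z h0 _).1 (by linarith [hx h0 z])
    have := (neg_le_ordAt_iff z hfg (D z)).2
      ((Valuation.map_add _ f g).trans (max_le (key f hf) (key g hg)))
    linarith
  smul_mem' := by
    intro a f hf haf z
    have hf0 : f ≠ 0 := by
      rintro rfl
      exact haf (smul_zero a)
    have h1 : z.valuation K f ≤ WithZero.exp (D z) :=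
      (neg_le_ordAt_iff z hf0 _).1 (by linarith [hf hf0 z])
    have h2 : z.valuation K (a • f) ≤ WithZero.exp (D z) := by
      rw [Algebra.smul_def, map_mul]
      exact (mul_le_of_le_one_left' (z.valuation_le_one a)).trans h1
    have := (neg_le_ordAt_iff z haf (D z)).2 h2
    linarith

theorem mem_globalSections {D : IsDedekindDomain.HeightOneSpectrum A₀ →₀ ℤ} {f : K} :
    f ∈ globalSections K D ↔ (f ≠ 0 → ∀ z, 0 ≤ ordAt z f + D z) := Iff.rfl

theorem ordAt_one (z : IsDedekindDomain.HeightOneSpectrum A₀) : ordAt z (1 : K) = 0 := by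
  simp [ordAt]

theorem ordAt_mul (z : IsDedekindDomain.HeightOneSpectrum A₀) {f g : K} (hf : f ≠ 0)
    (hg : g ≠ 0) : ordAt z (f * g) = ordAt z f + ordAt z g := by
  rw [ordAt, map_mul, WithZero.log_mul (by simpa using hf) (by simpa using hg), ordAt, ordAt]
  ring

theorem mul_mem_globalSections {D D' D'' : IsDedekindDomain.HeightOneSpectrum A₀ →₀ ℤ}
    (h : ∀ z, D z + D' z ≤ D'' z) {f g : K} (hf : f ∈ globalSections K D)
    (hg : g ∈ globalSections K D') : f * g ∈ globalSections K D'' := by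
  intro h0 z
  have hf0 := left_ne_zero_of_mul h0
  have hg0 := right_ne_zero_of_mul h0
  rw [ordAt_mul z hf0 hg0]
  linarith [hf hf0 z, hg hg0 z, h z]

end Dedekind

/-- A `σ`-polyhedral divisor `∑ Δ_z · z` over the Dedekind domain `A₀`; `z` runs over the
closed points of `Spec A₀`, i.e. the nonzero prime ideals of `A₀`. -/
@[ext]
structure PolyhedralDivisor (A₀ : Type*) [CommRing A₀] {N : Type*} [AddCommGroup N]
    (σ : PointedCone ℚ (RatSpace N)) where
  coeff : IsDedekindDomain.HeightOneSpectrum A₀ → Set (RatSpace N)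
  isSigmaPolyhedron : ∀ z, IsSigmaPolyhedron σ (coeff z)
  finite_support : {z | coeff z ≠ (σ : Set (RatSpace N))}.Finite

namespace PolyhedralDivisor

variable {A₀ : Type*} [CommRing A₀] {N : Type*} [AddCommGroup N]
  {σ : PointedCone ℚ (RatSpace N)}

/-- The value `h_{Δ_z}(u) = min_{v ∈ Δ_z} ⟨u, v⟩` of the support function at `u ∈ σ^∨`. -/
noncomputable def supportValue (D : PolyhedralDivisor A₀ σ)
    (z : IsDedekindDomain.HeightOneSpectrum A₀) {u : DualRatSpace N} (hu : u ∈ dualCone σ) : ℚ :=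
  ((D.isSigmaPolyhedron z).exists_isLeast hu).choose

theorem isLeast_supportValue (D : PolyhedralDivisor A₀ σ)
    (z : IsDedekindDomain.HeightOneSpectrum A₀) {u : DualRatSpace N} (hu : u ∈ dualCone σ) :
    IsLeast (u '' D.coeff z) (D.supportValue z hu) :=
  ((D.isSigmaPolyhedron z).exists_isLeast hu).choose_spec

theorem supportValue_eq_zero (D : PolyhedralDivisor A₀ σ)
    {z : IsDedekindDomain.HeightOneSpectrum A₀} (hz : D.coeff z = σ)
    {u : DualRatSpace N} (hu : u ∈ dualCone σ) : D.supportValue z hu = 0 := by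
  refine (D.isLeast_supportValue z hu).unique ⟨⟨0, ?_, map_zero u⟩, ?_⟩
  · rw [hz]
    exact σ.zero_mem
  · rintro _ ⟨v, hv, rfl⟩
    rw [hz] at hv
    exact mem_dualCone.1 hu v hv

theorem supportValue_add_le (D : PolyhedralDivisor A₀ σ)
    (z : IsDedekindDomain.HeightOneSpectrum A₀) {u u' : DualRatSpace N} (hu : u ∈ dualCone σ)
    (hu' : u' ∈ dualCone σ) (huu' : u + u' ∈ dualCone σ) :
    D.supportValue z hu + D.supportValue z hu' ≤ D.supportValue z huu' := by
  obtain ⟨v, hv, h⟩ := (D.isLeast_supportValue z huu').1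
  rw [← h, LinearMap.add_apply]
  exact add_le_add ((D.isLeast_supportValue z hu).2 ⟨v, hv, rfl⟩)
    ((D.isLeast_supportValue z hu').2 ⟨v, hv, rfl⟩)

/-- The evaluation `𝔇(u) = ∑ h_{Δ_z}(u) · z` at `u ∈ σ^∨`, a rational Weil divisor. -/
noncomputable def eval (D : PolyhedralDivisor A₀ σ) {u : DualRatSpace N}
    (hu : u ∈ dualCone σ) : IsDedekindDomain.HeightOneSpectrum A₀ →₀ ℚ :=
  Finsupp.ofSupportFinite (fun z => D.supportValue z hu)
    (D.finite_support.subset fun _ hz h => hz (D.supportValue_eq_zero h hu))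

theorem eval_apply (D : PolyhedralDivisor A₀ σ) {u : DualRatSpace N}
    (hu : u ∈ dualCone σ) (z : IsDedekindDomain.HeightOneSpectrum A₀) :
    D.eval hu z = D.supportValue z hu := rfl

/-- The integral Weil divisor `⌊𝔇(u)⌋`. -/
noncomputable def floorEval (D : PolyhedralDivisor A₀ σ) {u : DualRatSpace N}
    (hu : u ∈ dualCone σ) : IsDedekindDomain.HeightOneSpectrum A₀ →₀ ℤ :=
  (D.eval hu).mapRange (fun q : ℚ => ⌊q⌋) Int.floor_zero

theorem floorEval_apply (D : PolyhedralDivisor A₀ σ) {u : DualRatSpace N}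
    (hu : u ∈ dualCone σ) (z : IsDedekindDomain.HeightOneSpectrum A₀) :
    D.floorEval hu z = ⌊D.supportValue z hu⌋ := rfl

section Algebra

variable [IsDedekindDomain A₀] (K : Type*) [Field K] [Algebra A₀ K] [IsFractionRing A₀ K]

open Classical in
/-- The graded piece `H⁰(Y, O_Y(⌊𝔇(u)⌋)) ⊆ K₀` for `u ∈ σ^∨`, and `0` for `u ∉ σ^∨`. -/
noncomputable def piece (D : PolyhedralDivisor A₀ σ) (u : DualRatSpace N) : Submodule A₀ K :=
  if hu : u ∈ dualCone σ then globalSections K (D.floorEval hu) else ⊥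

theorem mem_piece {D : PolyhedralDivisor A₀ σ} {u : DualRatSpace N} (hu : u ∈ dualCone σ)
    {f : K} : f ∈ D.piece K u ↔ (f ≠ 0 → ∀ z, 0 ≤ ordAt z f + ⌊D.supportValue z hu⌋) := by
  rw [piece, dif_pos hu, mem_globalSections]
  simp only [floorEval_apply]

theorem mem_piece_of_not_mem {D : PolyhedralDivisor A₀ σ} {u : DualRatSpace N}
    (hu : u ∉ dualCone σ) {f : K} : f ∈ D.piece K u ↔ f = 0 := by
  rw [piece, dif_neg hu, Submodule.mem_bot]

theorem one_mem_piece (D : PolyhedralDivisor A₀ σ) : (1 : K) ∈ D.piece K 0 := by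
  have h0 : (0 : DualRatSpace N) ∈ dualCone σ := (dualCone σ).zero_mem
  rw [mem_piece K h0]
  intro _ z
  obtain ⟨v, _, hv⟩ := (D.isLeast_supportValue z h0).1
  have : D.supportValue z h0 = 0 := by rw [← hv]; rfl
  simp [ordAt_one, this]

theorem mul_mem_piece (D : PolyhedralDivisor A₀ σ) {u u' : DualRatSpace N} {f g : K}
    (hf : f ∈ D.piece K u) (hg : g ∈ D.piece K u') : f * g ∈ D.piece K (u + u') := by
  by_cases hu : u ∈ dualCone σ
  · by_cases hu' : u' ∈ dualCone σ
    · have huu' := (dualCone σ).add_mem hu hu'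
      rw [piece, dif_pos hu] at hf
      rw [piece, dif_pos hu'] at hg
      rw [piece, dif_pos huu']
      refine mul_mem_globalSections (fun z => ?_) hf hg
      simp only [floorEval_apply]
      exact (Int.le_floor_add _ _).trans
        (Int.floor_le_floor (D.supportValue_add_le z hu hu' huu'))
    · rw [(mem_piece_of_not_mem K hu').1 hg, mul_zero]
      exact Submodule.zero_mem _
  · rw [(mem_piece_of_not_mem K hu).1 hf, zero_mul]
    exact Submodule.zero_mem _

/-- The algebra `A₀[𝔇] = ⨁_{m ∈ σ^∨ ∩ M} H⁰(Y, O_Y(⌊𝔇(m)⌋)) χ^m`, inside `K₀[M]`. -/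
noncomputable def sectionAlgebra (D : PolyhedralDivisor A₀ σ) :
    Subalgebra A₀ (AddMonoidAlgebra K (DualLattice N)) where
  carrier := {a | ∀ m : DualLattice N, a.coeff m ∈ D.piece K (toDualRat m)}
  algebraMap_mem' := by
    classical
    intro c m
    rw [AddMonoidAlgebra.coe_algebraMap, Function.comp_apply,
      AddMonoidAlgebra.coeff_single, Finsupp.single_apply]
    split_ifs with h
    · rw [← h, map_zero, Algebra.algebraMap_eq_smul_one]
      exact Submodule.smul_mem _ _ (D.one_mem_piece K)
    · exact Submodule.zero_mem _
  add_mem' := fun ha hb m => Submodule.add_mem _ (ha m) (hb m)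
  mul_mem' := by
    classical
    intro a b ha hb m
    rw [AddMonoidAlgebra.coeff_mul]
    refine Submodule.sum_mem _ fun x _ => Submodule.sum_mem _ fun y _ => ?_
    dsimp only
    split_ifs with h
    · rw [← h, map_add]
      exact D.mul_mem_piece K (ha x) (hb y)
    · exact Submodule.zero_mem _

theorem mem_sectionAlgebra {D : PolyhedralDivisor A₀ σ}
    {a : AddMonoidAlgebra K (DualLattice N)} :
    a ∈ D.sectionAlgebra K ↔ ∀ m : DualLattice N, a.coeff m ∈ D.piece K (toDualRat m) :=
  Iff.rfl

end Algebra

end PolyhedralDivisor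

section Graded

variable {A₀ : Type*} [CommRing A₀] {K : Type*} [Field K] [Algebra A₀ K]
  {N : Type*} [AddCommGroup N]

/-- The graded piece `A_m ⊆ K₀` of `A ⊆ K₀[M]`: the `f ∈ K₀` with `f χ^m ∈ A`. -/
noncomputable def gradedPiece (A : Subalgebra A₀ (AddMonoidAlgebra K (DualLattice N)))
    (m : DualLattice N) : Submodule A₀ K where
  carrier := {f | AddMonoidAlgebra.single m f ∈ A}
  zero_mem' := by simp
  add_mem' := by
    intro f g hf hg
    simpa [AddMonoidAlgebra.single_add] using A.add_mem hf hg
  smul_mem' := by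
    intro c f hf
    simpa [AddMonoidAlgebra.smul_single] using A.smul_mem hf c

/-- `A` is an `M`-graded subalgebra of `K₀[M]`: `A = ⨁_m A_m χ^m`, that is, each homogeneous
component of an element of `A` lies in `A`. -/
def IsGradedSubalgebra (A : Subalgebra A₀ (AddMonoidAlgebra K (DualLattice N))) : Prop :=
  ∀ a ∈ A, ∀ m, a.coeff m ∈ gradedPiece A m

/-- The weight cone of `A`: the cone of `M_ℚ` generated by the `m` with `A_m ≠ 0`. -/
noncomputable def weightCone (A : Subalgebra A₀ (AddMonoidAlgebra K (DualLattice N))) :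
    PointedCone ℚ (DualRatSpace N) :=
  PointedCone.hull ℚ (toDualRat '' {m | gradedPiece A m ≠ ⊥})

/-- `A` has the same fraction field as `K₀[M]`: the fraction field of `K₀[M]` is, via the
inclusion, a fraction field of `A`. -/
def HasFullFractionField (A : Subalgebra A₀ (AddMonoidAlgebra K (DualLattice N))) : Prop :=
  IsFractionRing A (FractionRing (AddMonoidAlgebra K (DualLattice N)))

/-- The integral closure of `A` in the fraction field of `K₀[M]`; this is the normalization
of `A` when `A` has the same fraction field as `K₀[M]`. -/
noncomputable def normalizationIn (A : Subalgebra A₀ (AddMonoidAlgebra K (DualLattice N))) :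
    Subalgebra A₀ (FractionRing (AddMonoidAlgebra K (DualLattice N))) :=
  (integralClosure A (FractionRing (AddMonoidAlgebra K (DualLattice N)))).restrictScalars A₀

/-- The image of `B ⊆ K₀[M]` in the fraction field of `K₀[M]`. -/
noncomputable def imageInFractionField
    (B : Subalgebra A₀ (AddMonoidAlgebra K (DualLattice N))) :
    Subalgebra A₀ (FractionRing (AddMonoidAlgebra K (DualLattice N))) :=
  B.map (IsScalarTower.toAlgHom A₀ (AddMonoidAlgebra K (DualLattice N))
    (FractionRing (AddMonoidAlgebra K (DualLattice N))))

end Graded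

/-- The dual in `N_ℚ` of the cone of `M_ℚ` generated by `m_1, …, m_r`. -/
noncomputable def dualOfWeights {N : Type*} [AddCommGroup N] {r : ℕ}
    (m : Fin r → DualLattice N) : PointedCone ℚ (RatSpace N) :=
  PointedCone.dual LinearMap.id
    (PointedCone.hull ℚ (Set.range fun i => toDualRat (m i)) : Set (DualRatSpace N))

/-- `Δ_z[f] = {v ∈ N_ℚ : ⟨m_i, v⟩ ≥ -ord_z f_i for all i}`. -/
noncomputable def generatorPolyhedron {A₀ : Type*} [CommRing A₀] [IsDedekindDomain A₀]
    {K : Type*} [Field K] [Algebra A₀ K] [IsFractionRing A₀ K] {N : Type*} [AddCommGroup N]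
    {r : ℕ} (f : Fin r → K) (m : Fin r → DualLattice N)
    (z : IsDedekindDomain.HeightOneSpectrum A₀) : Set (RatSpace N) :=
  {v | ∀ i, -(ordAt z (f i) : ℚ) ≤ toDualRat (m i) v}

/-! Everything is reduced to homogeneous elements. For `f ≠ 0`, the element `f χ^m` lies in `A₀[𝔇]`
exactly when `m ∈ σ^∨` and `ord_z f + ⟨m, v⟩ ≥ 0` for all `z` and all `v ∈ Δ_z`; the floor
disappears because orders are integers (`nonneg_add_floor_iff`). These inequalities are linear, so
if they hold for all `g f^n χ^(l + n m)` they hold for `f χ^m`. The algebra thus contains the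
homogeneous elements almost integral over it, and peeling off leading terms inside the normal ring
`K₀[M]` gives normality (`mem_of_forall_mul_pow_mem`, `isIntegrallyClosed_of_homogeneous`). The
fraction field is full because `σ^∨` spans `M_ℚ`. Finite generation, hence noetherianity, combines
Gordan's lemma for the pairs `(m, e)` with `e` an integral divisor below `𝔇(m)` and the fact that
products of sections of `O(D)` and `O(D')` span those of `O(D + D')` (`globalSections_add_le`).

The normalization statement is linear programming duality. If `b χ^k` is a section of `𝔇[f]`, the
bound `⟨k, v⟩ ≥ -ord_z b` on `Δ_z[f]` follows from a nonnegative rational combination of the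
defining inequalities. With denominators cleared by a common `n`, this is a monomial in the
generators, of weight `n k`, whose coefficient has order at most `ord_z (b^n)` at `z`. Finitely many
such coefficients span a fractional ideal containing `b^n`, so `(b χ^k)^n` lies in `A`
(`isIntegral_single_of_mem_sectionAlgebra`). Conversely `A` lies in `A₀[𝔇[f]]`, which is normal.

For a given normal noetherian `A`, Hilbert's basis theorem supplies homogeneous generators
(`exists_adjoin_eq_of_isNoetherianRing`). An empty `Δ_z[f]` would, by Farkas, give an element of
weight zero with a pole at `z`, contradicting `A_0 = A₀`; so the previous paragraph applies and `A`
equals its normalization. Uniqueness: a point outside a `σ`-polyhedron is separated from it by a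
form in `σ^∨`, and global generation of `O(D)` recovers `D` from its sections. -/

/-! ### Duality of finitely generated cones. -/

namespace PointedCone

variable {𝕜 V : Type*} [Field 𝕜] [LinearOrder 𝕜] [IsStrictOrderedRing 𝕜]
  [AddCommGroup V] [Module 𝕜 V]

/-- Fourier–Motzkin elimination: adding a ray to an intersection of finitely many half-spaces
gives an intersection of finitely many half-spaces. -/
theorem DualFG.sup_hull_singleton {C : PointedCone 𝕜 V}
    (hC : C.DualFG (LinearMap.id : Module.Dual 𝕜 V →ₗ[𝕜] Module.Dual 𝕜 V)) (x : V) :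
    (hull 𝕜 {x} ⊔ C).DualFG (LinearMap.id : Module.Dual 𝕜 V →ₗ[𝕜] Module.Dual 𝕜 V) := by
  classical
  obtain ⟨s, rfl⟩ := hC
  -- The forms of `s` nonnegative on `x`, together with the positive combinations of a form positive
  -- and a form negative on `x` that vanish on `x`.
  let T : Finset (Module.Dual 𝕜 V) := s.filter (fun u => 0 ≤ u x) ∪
    ((s.filter fun u => 0 < u x) ×ˢ (s.filter fun u => u x < 0)).image
      fun p => p.1 x • p.2 - p.2 x • p.1
  refine ⟨T, le_antisymm (fun y hy => ?_) ?_⟩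
  · have h1 : ∀ u ∈ s, 0 ≤ u x → 0 ≤ u y := fun u hu hux =>
      hy (x := u) (by simp [T, hu, hux])
    have h2 : ∀ u ∈ s, ∀ w ∈ s, 0 < u x → w x < 0 → 0 ≤ u x * w y - w x * u y := by
      intro u hu w hw hux hwx
      have := hy (x := u x • w - w x • u) (by
        simp only [T, Finset.coe_union, Set.mem_union]
        right
        simp only [Finset.coe_image, Set.mem_image]
        exact ⟨(u, w), by simp [hu, hw, hux, hwx], rfl⟩)
      simpa using this
    -- For `y - t • x` to lie in `C`, forms negative on `x` bound `t` below and forms positive on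
    -- `x` bound it above; take the largest lower bound, with `0` included since `t` must be
    -- nonnegative.
    obtain ⟨t, ht, hmax⟩ := Finset.exists_max_image
      (insert 0 ((s.filter fun u => u x < 0).image fun w => w y / w x)) (fun l => l)
      (Finset.insert_nonempty _ _)
    have ht0 : 0 ≤ t := hmax 0 (by simp)
    have hmem : y - t • x ∈ dual (LinearMap.id : Module.Dual 𝕜 V →ₗ[𝕜] Module.Dual 𝕜 V)
        (s : Set (Module.Dual 𝕜 V)) := by
      intro u hu
      simp only [LinearMap.id_coe, id_eq, map_sub, map_smul, smul_eq_mul, sub_nonneg]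
      rcases lt_trichotomy (u x) 0 with hux | hux | hux
      · have : u y / u x ≤ t := hmax (u y / u x) (by
          refine Finset.mem_insert_of_mem (Finset.mem_image.2 ⟨u, ?_, rfl⟩)
          simpa using ⟨hu, hux⟩)
        rwa [div_le_iff_of_neg hux] at this
      · simpa [hux] using h1 u hu hux.ge
      · rcases Finset.mem_insert.1 ht with rfl | ht
        · simpa using h1 u hu hux.le
        · obtain ⟨w, hw, rfl⟩ := Finset.mem_image.1 ht
          rw [Finset.mem_filter] at hw
          have h3 := h2 u hu w hw.1 hux hw.2
          have h4 : w y / w x * u x - u y = (u x * w y - w x * u y) / w x := by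
            field_simp [hw.2.ne]
          have h5 := div_nonpos_of_nonneg_of_nonpos h3 hw.2.le
          linarith
    have : y = t • x + (y - t • x) := by abel
    rw [this]
    refine Submodule.add_mem_sup ?_ hmem
    exact (hull 𝕜 {x}).smul_mem ht0 (subset_hull rfl)
  · refine sup_le (Submodule.span_le.2 ?_) ?_
    · rintro _ rfl u hu
      simp only [T, Finset.coe_union, Set.mem_union] at hu
      rcases hu with hu | hu
      · simp only [Finset.coe_filter, Set.mem_ofPred_eq] at hu
        exact hu.2
      · simp only [Finset.coe_image, Set.mem_image] at hu
        obtain ⟨p, -, rfl⟩ := hu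
        simp [mul_comm]
    · intro y hy u hu
      simp only [T, Finset.coe_union, Set.mem_union] at hu
      rcases hu with hu | hu
      · simp only [Finset.coe_filter, Set.mem_ofPred_eq] at hu
        exact hy hu.1
      · simp only [Finset.coe_image, Set.mem_image] at hu
        obtain ⟨p, hp, rfl⟩ := hu
        simp only [Finset.coe_product, Finset.coe_filter, Set.mem_prod, Set.mem_ofPred_eq] at hp
        have h1 : 0 ≤ p.1 y := hy hp.1.1
        have h2 : 0 ≤ p.2 y := hy hp.2.1
        have h3 := mul_nonneg hp.1.2.le h2
        have h4 := mul_nonneg (neg_nonneg.2 hp.2.2.le) h1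
        simp only [LinearMap.id_coe, id_eq, LinearMap.sub_apply, LinearMap.smul_apply, smul_eq_mul]
        linarith

variable [FiniteDimensional 𝕜 V]

/-- A finitely generated cone is an intersection of finitely many half-spaces. -/
theorem FG.dualFG_id {C : PointedCone 𝕜 V} (hC : C.FG) :
    C.DualFG (LinearMap.id : Module.Dual 𝕜 V →ₗ[𝕜] Module.Dual 𝕜 V) := by
  classical
  obtain ⟨s, rfl⟩ := hC
  induction s using Finset.induction_on with
  | empty =>
    let b := Module.finBasis 𝕜 V
    have hfin : (Set.range b.coord ∪ Set.range fun i => -b.coord i).Finite :=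
      (Set.finite_range _).union (Set.finite_range _)
    convert DualFG.dual_of_finite
      (LinearMap.id : Module.Dual 𝕜 V →ₗ[𝕜] Module.Dual 𝕜 V) hfin
    refine le_antisymm (by simp) fun y hy => ?_
    have : y = 0 := by
      refine b.ext_elem fun i => ?_
      have h1 : 0 ≤ b.coord i y := hy (Or.inl ⟨i, rfl⟩)
      have h2 : 0 ≤ (-b.coord i) y := hy (Or.inr ⟨i, rfl⟩)
      simp only [LinearMap.neg_apply, Module.Basis.coord_apply] at h1 h2
      rw [map_zero, Finsupp.zero_apply]
      linarith
    rw [this]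
    exact Submodule.zero_mem _
  | insert a s _ ih =>
    rw [Finset.coe_insert, Submodule.span_insert]
    exact ih.sup_hull_singleton a

/-- The bidual of a finitely generated cone of `V` is the cone itself. -/
theorem FG.dual_id_dual_eval {C : PointedCone 𝕜 V} (hC : C.FG) :
    dual (LinearMap.id : Module.Dual 𝕜 V →ₗ[𝕜] Module.Dual 𝕜 V)
      (dual (Module.Dual.eval 𝕜 V) (C : Set V) : Set (Module.Dual 𝕜 V)) = C :=
  (FG.dualFG_id hC).dual_dual_flip

/-- A finitely generated cone of the dual space is cut out by finitely many vectors. -/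
theorem FG.dualFG_eval {C : PointedCone 𝕜 (Module.Dual 𝕜 V)} (hC : C.FG) :
    C.DualFG (Module.Dual.eval 𝕜 V) := by
  classical
  obtain ⟨s, rfl⟩ := FG.dualFG_id hC
  refine ⟨s.image (Module.evalEquiv 𝕜 V).symm, ?_⟩
  ext u
  simp only [Finset.coe_image, mem_dual, Set.forall_mem_image, Module.Dual.eval_apply,
    Module.apply_evalEquiv_symm_apply, LinearMap.id_apply]

/-- The bidual of a finitely generated cone of the dual space is the cone itself. -/
theorem FG.dual_eval_dual_id {C : PointedCone 𝕜 (Module.Dual 𝕜 V)} (hC : C.FG) :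
    dual (Module.Dual.eval 𝕜 V)
      (dual (LinearMap.id : Module.Dual 𝕜 V →ₗ[𝕜] Module.Dual 𝕜 V)
        (C : Set (Module.Dual 𝕜 V)) : Set V) = C :=
  (FG.dualFG_eval hC).dual_dual_flip

/-- An intersection of finitely many half-spaces is a finitely generated cone. -/
theorem DualFG.fg {C : PointedCone 𝕜 V}
    (hC : C.DualFG (LinearMap.id : Module.Dual 𝕜 V →ₗ[𝕜] Module.Dual 𝕜 V)) : C.FG := by
  -- `C` is the dual of a finitely generated `D`, itself the dual of a finitely generated `E`;
  -- biduality gives `C = E`.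
  obtain ⟨D, hD, rfl⟩ := hC.exists_fg_dual
  obtain ⟨E, hE, rfl⟩ := (FG.dualFG_eval hD).exists_fg_dual
  rwa [FG.dual_id_dual_eval hE]

/-- **Farkas' lemma**: a linear form which is nonnegative wherever finitely many linear forms are
nonnegative is a nonnegative combination of them. -/
theorem exists_nonneg_combination {ι : Type*} [Fintype ι] (g : ι → Module.Dual 𝕜 V)
    (G : Module.Dual 𝕜 V) (h : ∀ v, (∀ i, 0 ≤ g i v) → 0 ≤ G v) :
    ∃ c : ι → 𝕜, (∀ i, 0 ≤ c i) ∧ ∑ i, c i • g i = G := by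
  have hG : G ∈ hull 𝕜 (Set.range g) := by
    have hfg : (hull 𝕜 (Set.range g)).FG := Submodule.fg_span (Set.finite_range g)
    rw [← FG.dual_eval_dual_id hfg]
    intro v hv
    exact h v fun i => hv (subset_hull ⟨i, rfl⟩)
  obtain ⟨c, hc⟩ := (Submodule.mem_span_range_iff_exists_fun _).1 hG
  exact ⟨fun i => c i, fun i => (c i).2, hc⟩

end PointedCone

/-! ### Affine Farkas lemma and linear programming duality. -/

section AffineFarkas

variable {𝕜 V ι : Type*} [Field 𝕜] [LinearOrder 𝕜] [IsStrictOrderedRing 𝕜]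
  [AddCommGroup V] [Module 𝕜 V] [FiniteDimensional 𝕜 V] [Fintype ι]

/-- A combination of Farkas' lemma for the homogenization of the system `c i ≤ u i v`. -/
theorem exists_nonneg_combination_prod (u : ι → Module.Dual 𝕜 V) (c : ι → 𝕜)
    (w : Module.Dual 𝕜 V) (d : 𝕜)
    (h : ∀ (v : V) (t : 𝕜), 0 ≤ t → (∀ i, t * c i ≤ u i v) → t * d ≤ w v) :
    ∃ l : ι → 𝕜, (∀ i, 0 ≤ l i) ∧ ∑ i, l i • u i = w ∧ d ≤ ∑ i, l i * c i := by
  -- Index `none` carries the inequality `0 ≤ t` of the homogenized system, index `some i` the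
  -- inequality `t * c i ≤ u i v`.
  let g : Option ι → Module.Dual 𝕜 (V × 𝕜) := fun o =>
    o.elim (LinearMap.snd 𝕜 V 𝕜) fun i =>
      u i ∘ₗ LinearMap.fst 𝕜 V 𝕜 - c i • LinearMap.snd 𝕜 V 𝕜
  obtain ⟨l, hl, hG⟩ := PointedCone.exists_nonneg_combination g
    (w ∘ₗ LinearMap.fst 𝕜 V 𝕜 - d • LinearMap.snd 𝕜 V 𝕜) (by
      rintro ⟨v, t⟩ hvt
      have ht : 0 ≤ t := hvt none
      have := h v t ht (fun i => by
        have := hvt (some i)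
        simp only [g, Option.elim_some, LinearMap.sub_apply, LinearMap.comp_apply,
          LinearMap.fst_apply, LinearMap.smul_apply, LinearMap.snd_apply, smul_eq_mul] at this
        linarith)
      simp only [LinearMap.sub_apply, LinearMap.comp_apply,
          LinearMap.fst_apply, LinearMap.smul_apply, LinearMap.snd_apply, smul_eq_mul]
      linarith)
  rw [Fintype.sum_option] at hG
  refine ⟨fun i => l (some i), fun i => hl _, ?_, ?_⟩
  · ext v
    have := LinearMap.congr_fun hG (v, 0)
    simpa [g, LinearMap.sum_apply] using this
  -- The multiplier of `0 ≤ t` is the slack between `d` and `∑ l i * c i`.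
  · have := LinearMap.congr_fun hG (0, 1)
    simp only [g, LinearMap.add_apply, LinearMap.sum_apply, LinearMap.smul_apply,
      Option.elim_some, Option.elim_none, LinearMap.sub_apply, LinearMap.comp_apply,
      LinearMap.fst_apply, LinearMap.snd_apply, smul_eq_mul, map_zero, mul_one, zero_sub,
      mul_neg, Finset.sum_neg_distrib] at this
    linarith [hl none]

/-- Linear programming duality: a lower bound of a linear form on a nonempty polyhedron is a
nonnegative combination of the inequalities which define it. -/
theorem exists_combination_of_le_on_polyhedron (u : ι → Module.Dual 𝕜 V) (c : ι → 𝕜)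
    {v₀ : V} (hv₀ : ∀ i, c i ≤ u i v₀) (w : Module.Dual 𝕜 V) (d : 𝕜)
    (h : ∀ v, (∀ i, c i ≤ u i v) → d ≤ w v) :
    ∃ l : ι → 𝕜, (∀ i, 0 ≤ l i) ∧ ∑ i, l i • u i = w ∧ d ≤ ∑ i, l i * c i := by
  refine exists_nonneg_combination_prod u c w d fun v t ht hv => ?_
  -- At `t = 0`, `v` is a recession direction: if `w v < 0`, moving from `v₀` far along `v` stays in
  -- the polyhedron and lowers `w` by `|w v₀ - d| + 1`, below `d`.
  rcases ht.eq_or_lt with rfl | ht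
  · simp only [zero_mul] at hv ⊢
    by_contra! hneg
    have hs : 0 ≤ (|w v₀ - d| + 1) / -w v := by
      have : 0 < -w v := by linarith
      positivity
    have := h (v₀ + ((|w v₀ - d| + 1) / -w v) • v) fun i => by
      rw [map_add, map_smul, smul_eq_mul]
      have := mul_nonneg hs (hv i)
      linarith [hv₀ i]
    rw [map_add, map_smul, smul_eq_mul] at this
    have h2 : (|w v₀ - d| + 1) / -w v * w v = -(|w v₀ - d| + 1) := by
      field_simp [hneg.ne]
    have h3 := le_abs_self (w v₀ - d)
    linarith
  · have := h (t⁻¹ • v) fun i => by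
      rw [map_smul, smul_eq_mul, ← div_eq_inv_mul, le_div_iff₀ ht]
      linarith [hv i]
    rw [map_smul, smul_eq_mul, ← div_eq_inv_mul, le_div_iff₀ ht] at this
    linarith

/-- An infeasible system of linear inequalities has a certificate of infeasibility. -/
theorem exists_certificate_of_infeasible (u : ι → Module.Dual 𝕜 V) (c : ι → 𝕜)
    (h : ¬ ∃ v, ∀ i, c i ≤ u i v) :
    ∃ l : ι → 𝕜, (∀ i, 0 ≤ l i) ∧ ∑ i, l i • u i = 0 ∧ 0 < ∑ i, l i * c i := by
  -- With `w = 0` and `d = 1` the implication to check is `t ≤ 0`: a solution with `t > 0` would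
  -- rescale to a feasible point.
  obtain ⟨l, hl, hu, hc⟩ := exists_nonneg_combination_prod u c 0 1 fun v t ht hv => by
    rcases ht.eq_or_lt with rfl | ht
    · simp
    · refine absurd ⟨t⁻¹ • v, fun i => ?_⟩ h
      rw [map_smul, smul_eq_mul, ← div_eq_inv_mul, le_div_iff₀ ht]
      linarith [hv i]
  exact ⟨l, hl, hu, zero_lt_one.trans_le hc⟩

end AffineFarkas

/-! ### Decomposition and separation of polyhedra. -/

section Polyhedron

variable {𝕜 V : Type*} [Field 𝕜] [LinearOrder 𝕜] [IsStrictOrderedRing 𝕜]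
  [AddCommGroup V] [Module 𝕜 V]

/-- Dehomogenization: generators at positive height rescale into `Q`, those at height zero are
recession directions. Sums cause no trouble because `(s + t) • C = s • C + t • C` for convex `C` and
`s, t ≥ 0`. -/
theorem mem_smul_convexHull_add_of_mem_hull {S : Set (V × 𝕜)} {Q : Set V} (hQ : Q.Nonempty)
    (σ : PointedCone 𝕜 V)
    (hS : ∀ s ∈ S, 0 < s.2 ∧ s.2⁻¹ • s.1 ∈ Q ∨ s.2 = 0 ∧ s.1 ∈ σ)
    {x : V × 𝕜} (hx : x ∈ PointedCone.hull 𝕜 S) :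
    0 ≤ x.2 ∧ x.1 ∈ x.2 • convexHull 𝕜 Q + (σ : Set V) := by
  obtain ⟨q, hq⟩ := hQ
  induction hx using Submodule.span_induction with
  | mem s hs =>
    rcases hS s hs with ⟨h1, h2⟩ | ⟨h1, h2⟩
    · refine ⟨h1.le, s.1, ?_, 0, σ.zero_mem, add_zero _⟩
      rw [Set.mem_smul_set_iff_inv_smul_mem₀ h1.ne']
      exact subset_convexHull 𝕜 Q h2
    · refine ⟨h1.ge, 0, ?_, s.1, h2, zero_add _⟩
      exact ⟨q, subset_convexHull 𝕜 Q hq, by simp [h1]⟩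
  | zero =>
    exact ⟨le_rfl, 0, ⟨q, subset_convexHull 𝕜 Q hq, zero_smul _ _⟩, 0, σ.zero_mem, add_zero _⟩
  | add x y _ _ hx hy =>
    obtain ⟨hx0, a, ha, s, hs, hxa⟩ := hx
    obtain ⟨hy0, b, hb, t, ht, hyb⟩ := hy
    refine ⟨add_nonneg hx0 hy0, a + b, ?_, s + t, σ.add_mem hs ht, ?_⟩
    · rw [Prod.snd_add, (convex_convexHull 𝕜 Q).add_smul hx0 hy0]
      exact Set.add_mem_add ha hb
    · rw [Prod.fst_add, ← hxa, ← hyb]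
      exact add_add_add_comm a b s t
  | smul c x _ hx =>
    obtain ⟨hx0, a, ⟨p, hp, hpa⟩, s, hs, hxa⟩ := hx
    refine ⟨mul_nonneg c.2 hx0, (c : 𝕜) • a, ⟨p, hp, ?_⟩, (c : 𝕜) • s, σ.smul_mem c.2 hs, ?_⟩
    · rw [← hpa]
      exact mul_smul _ _ _
    · rw [Prod.smul_fst, ← hxa, Nonneg.mk_smul, smul_add]

variable [FiniteDimensional 𝕜 V]

/-- A nonempty polyhedron is the sum of a polytope and of its recession cone. -/
theorem exists_convexHull_add_eq_polyhedron {ι : Type*} [Finite ι] (u : ι → Module.Dual 𝕜 V)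
    (c : ι → 𝕜) (hne : ∃ v, ∀ i, c i ≤ u i v) (σ : PointedCone 𝕜 V)
    (hσ : ∀ v, v ∈ σ ↔ ∀ i, 0 ≤ u i v) :
    ∃ Q : Set V, Q.Finite ∧ Q.Nonempty ∧
      {v | ∀ i, c i ≤ u i v} = convexHull 𝕜 Q + (σ : Set V) := by
  let g : Option ι → Module.Dual 𝕜 (V × 𝕜) := fun o =>
    o.elim (LinearMap.snd 𝕜 V 𝕜) fun i =>
      u i ∘ₗ LinearMap.fst 𝕜 V 𝕜 - c i • LinearMap.snd 𝕜 V 𝕜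
  have hmem : ∀ x : V × 𝕜, x ∈ PointedCone.dual
      (LinearMap.id : Module.Dual 𝕜 (V × 𝕜) →ₗ[𝕜] _) (Set.range g) ↔
      0 ≤ x.2 ∧ ∀ i, x.2 * c i ≤ u i x.1 := by
    intro x
    rw [PointedCone.mem_dual, Set.forall_mem_range, Option.forall]
    refine and_congr Iff.rfl (forall_congr' fun i => ?_)
    simp [g, mul_comm]
  obtain ⟨S, hS⟩ := (PointedCone.DualFG.dual_of_finite
    (LinearMap.id : Module.Dual 𝕜 (V × 𝕜) →ₗ[𝕜] _) (Set.finite_range g)).fg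
  have hSmem : ∀ s ∈ S, 0 ≤ s.2 ∧ ∀ i, s.2 * c i ≤ u i s.1 := fun s hs => by
    rw [← hmem, ← hS]
    exact Submodule.subset_span hs
  -- The generators of the homogenized cone at positive height, rescaled to height one.
  let Q : Set V := (fun s : V × 𝕜 => s.2⁻¹ • s.1) '' {s | s ∈ S ∧ 0 < s.2}
  have hQ : Q.Finite := (S.finite_toSet.subset fun s hs => hs.1).image _
  have hSQ : ∀ s ∈ (S : Set (V × 𝕜)), 0 < s.2 ∧ s.2⁻¹ • s.1 ∈ Q ∨ s.2 = 0 ∧ s.1 ∈ σ := by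
    intro s hs
    rcases (hSmem s hs).1.eq_or_lt with h | h
    · refine Or.inr ⟨h.symm, (hσ _).2 fun i => ?_⟩
      simpa [← h] using (hSmem s hs).2 i
    · exact Or.inl ⟨h, s, ⟨hs, h⟩, rfl⟩
  have hlift : ∀ v, (∀ i, c i ≤ u i v) → (v, (1 : 𝕜)) ∈ PointedCone.hull 𝕜 (S : Set (V × 𝕜)) := by
    intro v hv
    have : (v, (1 : 𝕜)) ∈ PointedCone.dual
      (LinearMap.id : Module.Dual 𝕜 (V × 𝕜) →ₗ[𝕜] _) (Set.range g) :=
      (hmem _).2 ⟨zero_le_one, fun i => by simpa using hv i⟩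
    rwa [← hS] at this
  have hQne : Q.Nonempty := by
    by_contra hemp
    have h0 : ∀ x ∈ PointedCone.hull 𝕜 (S : Set (V × 𝕜)), x.2 = 0 := by
      intro x hx
      induction hx using Submodule.span_induction with
      | mem s hs =>
        rcases hSQ s hs with h | h
        · exact absurd ⟨_, h.2⟩ hemp
        · exact h.1
      | zero => rfl
      | add x y _ _ hx hy => rw [Prod.snd_add, hx, hy, add_zero]
      | smul c x _ hx => rw [Prod.smul_snd, hx, smul_zero]
    obtain ⟨v, hv⟩ := hne
    exact one_ne_zero (h0 _ (hlift v hv))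
  refine ⟨Q, hQ, hQne, Set.Subset.antisymm (fun v hv => ?_) ?_⟩
  · have := (mem_smul_convexHull_add_of_mem_hull hQne σ hSQ (hlift v hv)).2
    rwa [one_smul] at this
  · rintro _ ⟨a, ha, s, hs, rfl⟩ i
    have h1 : a ∈ {v | c i ≤ u i v} := by
      refine convexHull_min ?_ (convex_halfSpace_ge (u i).isLinear (c i)) ha
      rintro _ ⟨s, ⟨hs, h⟩, rfl⟩
      simp only [Set.mem_ofPred_eq, map_smul, smul_eq_mul]
      rw [← div_eq_inv_mul, le_div_iff₀ h]
      linarith [(hSmem s hs).2 i]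
    have h2 := (hσ s).1 hs i
    have h1' : c i ≤ u i a := h1
    simp only [map_add]
    linarith

/-- Points outside of the sum of a polytope and of a finitely generated cone are separated from it
by a linear form. -/
theorem exists_separating_form {Q : Set V} (hQ : Q.Finite) (hne : Q.Nonempty)
    {σ : PointedCone 𝕜 V} (hσ : σ.FG) {v : V} (hv : v ∉ convexHull 𝕜 Q + (σ : Set V)) :
    ∃ u : Module.Dual 𝕜 V, (∀ s ∈ σ, 0 ≤ u s) ∧ ∀ q ∈ Q, u v < u q := by
  obtain ⟨T, rfl⟩ := hσ
  let S : Set (V × 𝕜) := (fun q => (q, 1)) '' Q ∪ (fun s => (s, 0)) '' (T : Set V)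
  have hS : (PointedCone.hull 𝕜 S).FG :=
    Submodule.fg_span ((hQ.image _).union (T.finite_toSet.image _))
  have hvS : (v, (1 : 𝕜)) ∉ PointedCone.hull 𝕜 S := by
    intro h
    have := (mem_smul_convexHull_add_of_mem_hull hne (PointedCone.hull 𝕜 (T : Set V)) (by
      rintro _ (⟨q, hq, rfl⟩ | ⟨s, hs, rfl⟩)
      · exact Or.inl ⟨zero_lt_one, by simpa using hq⟩
      · exact Or.inr ⟨rfl, PointedCone.subset_hull hs⟩) h).2
    rw [one_smul] at this
    exact hv this
  rw [← PointedCone.FG.dual_id_dual_eval hS, PointedCone.dual_hull, PointedCone.mem_dual] at hvS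
  push Not at hvS
  obtain ⟨G, hG, hGv⟩ := hvS
  have hG' : ∀ s ∈ S, 0 ≤ G s := fun s hs => hG hs
  have hadd : ∀ (x : V) (t : 𝕜), G (x, t) = G (x, 0) + G (0, t) := fun x t => by
    rw [← map_add]; simp
  -- The constant `G (0, 1)` is common to `G (v, 1) < 0` and `0 ≤ G (q, 1)`, so it cancels in the
  -- comparison.
  refine ⟨G ∘ₗ LinearMap.inl 𝕜 V 𝕜, fun s hs => ?_, fun q hq => ?_⟩
  · change 0 ≤ G (s, 0)
    induction hs using Submodule.span_induction with
    | mem s hs => exact hG' _ (Or.inr ⟨s, hs, rfl⟩)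
    | zero => exact (map_zero G).ge
    | add x y _ _ hx hy =>
      have : ((x + y, 0) : V × 𝕜) = (x, 0) + (y, 0) := by simp
      rw [this, map_add]
      exact add_nonneg hx hy
    | smul c x _ hx =>
      have : ((c • x, 0) : V × 𝕜) = (c : 𝕜) • (x, 0) := by simp
      rw [this, map_smul]
      exact mul_nonneg c.2 hx
  · change G (v, 0) < G (q, 0)
    have h1 := hG' _ (Or.inl ⟨q, hq, rfl⟩)
    have h2 : G (v, 1) < 0 := hGv
    rw [hadd] at h1 h2
    linarith

end Polyhedron

/-! ### Clearing denominators in `N_ℚ` and `M_ℚ`. -/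

section Lattice

variable {N : Type*} [AddCommGroup N]

theorem exists_pos_smul_eq_tmul (v : RatSpace N) :
    ∃ k : ℕ, 0 < k ∧ ∃ n : N, (k : ℚ) • v = (1 : ℚ) ⊗ₜ[ℤ] n := by
  induction v using TensorProduct.induction_on with
  | zero => exact ⟨1, one_pos, 0, by simp⟩
  | tmul q n =>
    refine ⟨q.den, q.den_pos, q.num • n, ?_⟩
    rw [TensorProduct.smul_tmul', TensorProduct.tmul_smul, TensorProduct.smul_tmul', smul_eq_mul,
      Rat.den_mul_eq_num, zsmul_eq_mul, mul_one]
  | add x y hx hy =>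
    obtain ⟨k, hk, n, hn⟩ := hx
    obtain ⟨l, hl, m, hm⟩ := hy
    refine ⟨k * l, mul_pos hk hl, (l : ℤ) • n + (k : ℤ) • m, ?_⟩
    have h1 : ((k * l : ℕ) : ℚ) • (x + y) = (l : ℚ) • ((k : ℚ) • x) + (k : ℚ) • ((l : ℚ) • y) := by
      push_cast
      module
    rw [h1, hn, hm, TensorProduct.tmul_add, TensorProduct.tmul_smul, TensorProduct.tmul_smul]
    simp only [TensorProduct.smul_tmul', smul_eq_mul, mul_one, zsmul_eq_mul, Int.cast_natCast]

/-- Evaluation at a point of `N_ℚ` is, up to a positive integer, an integral form on `M`. -/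
theorem exists_intForm (v : RatSpace N) :
    ∃ k : ℕ, 0 < k ∧ ∃ l : DualLattice N →+ ℤ, ∀ m, (l m : ℚ) = k * toDualRat m v := by
  obtain ⟨k, hk, n, hn⟩ := exists_pos_smul_eq_tmul v
  refine ⟨k, hk, (LinearMap.applyₗ n).toAddMonoidHom, fun m => ?_⟩
  rw [← smul_eq_mul, ← map_smul, hn, toDualRat_tmul]
  simp

theorem toDualRat_injective : Function.Injective (toDualRat (N := N)) := by
  intro m m' h
  ext n
  have := LinearMap.congr_fun h ((1 : ℚ) ⊗ₜ[ℤ] n)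
  simpa [toDualRat_tmul] using this

variable [Module.Free ℤ N] [Module.Finite ℤ N]

/-- A rational linear form is, up to a positive integer, an element of `M`. -/
theorem exists_pos_smul_eq_toDualRat (u : DualRatSpace N) :
    ∃ k : ℕ, 0 < k ∧ ∃ m : DualLattice N, (k : ℚ) • u = toDualRat m := by
  classical
  let b := Module.Free.chooseBasis ℤ N
  let c : Module.Free.ChooseBasisIndex ℤ N → ℚ := fun i => u ((1 : ℚ) ⊗ₜ[ℤ] b i)
  let k : ℕ := ∏ i, (c i).den
  have hk : 0 < k := Finset.prod_pos fun i _ => (c i).den_pos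
  have hint : ∀ i, ∃ a : ℤ, (a : ℚ) = k * c i := by
    intro i
    obtain ⟨d, hd⟩ := Finset.dvd_prod_of_mem (fun i => (c i).den) (Finset.mem_univ i)
    have hd' : k = (c i).den * d := hd
    refine ⟨(c i).num * d, ?_⟩
    rw [hd']
    push_cast
    rw [mul_right_comm, Rat.den_mul_eq_num]
  choose a ha using hint
  refine ⟨k, hk, b.constr ℤ a, ?_⟩
  refine TensorProduct.AlgebraTensorModule.curry_injective ?_
  refine LinearMap.ext_ring ?_
  refine b.ext fun i => ?_
  have : toDualRat (b.constr ℤ a) ((1 : ℚ) ⊗ₜ[ℤ] b i) = k * c i := by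
    rw [toDualRat_tmul, b.constr_basis, ha, one_mul]
  simpa [c] using this.symm

end Lattice

/-! ### Gordan's lemma. -/

section Gordan

/-- **Gordan's lemma**: the elements of a finitely generated abelian group which satisfy finitely
many integral linear inequalities form a finitely generated monoid. -/
theorem AddSubmonoid.fg_of_forall_nonneg {G ι : Type*} [AddCommGroup G] [AddGroup.FG G] [Finite ι]
    (l : ι → G →+ ℤ) (S : AddSubmonoid G) (hS : ∀ x, x ∈ S ↔ ∀ i, 0 ≤ l i x) : S.FG := by
  have : Module.Finite ℕ G :=
    Module.Finite.iff_addMonoid_fg.2 (AddGroup.fg_iff_addMonoid_fg.1 inferInstance)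
  obtain ⟨n, π, hπ⟩ := Module.Finite.exists_fin' ℕ G
  -- With slack variables in `ℕ`, the inequalities become equations between two additive maps on a
  -- free commutative monoid, whose solution monoid is finitely generated.
  let f : (Fin n → ℕ) × (ι → ℕ) →+ (ι → ℤ) :=
    (AddMonoidHom.pi fun i => (l i).comp π.toAddMonoidHom).comp (AddMonoidHom.fst _ _)
  let g : (Fin n → ℕ) × (ι → ℕ) →+ (ι → ℤ) :=
    (AddMonoidHom.pi fun i => (Nat.castAddMonoidHom ℤ).comp (Pi.evalAddMonoidHom _ i)).comp
      (AddMonoidHom.snd _ _)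
  have h := (AddSubmonoid.fg_eqLocusM f g).map (π.toAddMonoidHom.comp (AddMonoidHom.fst _ _))
  convert h
  ext x
  rw [hS, AddSubmonoid.mem_map]
  constructor
  · intro hx
    obtain ⟨a, rfl⟩ := hπ x
    refine ⟨(a, fun i => (l i (π a)).toNat), ?_, rfl⟩
    funext i
    exact (Int.toNat_of_nonneg (hx i)).symm
  · rintro ⟨⟨a, y⟩, hy, rfl⟩ i
    have := congrFun hy i
    change l i (π a) = (y i : ℤ) at this
    change 0 ≤ l i (π a)
    rw [this]
    positivity

end Gordan

/-! ### Orders of vanishing and divisors over a Dedekind domain. -/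

section DedekindOrder

open IsDedekindDomain

variable {A₀ : Type*} [CommRing A₀] [IsDedekindDomain A₀]
  {K : Type*} [Field K] [Algebra A₀ K] [IsFractionRing A₀ K]

theorem ordAt_inv (z : HeightOneSpectrum A₀) (f : K) : ordAt z f⁻¹ = -ordAt z f := by
  rw [ordAt, map_inv₀, WithZero.log_inv, ordAt]

theorem ordAt_div (z : HeightOneSpectrum A₀) {f g : K} (hf : f ≠ 0) (hg : g ≠ 0) :
    ordAt z (f / g) = ordAt z f - ordAt z g := by
  rw [div_eq_mul_inv, ordAt_mul z hf (inv_ne_zero hg), ordAt_inv, sub_eq_add_neg]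

theorem ordAt_pow (z : HeightOneSpectrum A₀) (f : K) (n : ℕ) :
    ordAt z (f ^ n) = n * ordAt z f := by
  rw [ordAt, map_pow, WithZero.log_pow, ordAt, nsmul_eq_mul, mul_neg]

theorem ordAt_prod_pow (z : HeightOneSpectrum A₀) {ι : Type*} (s : Finset ι) (f : ι → K)
    (n : ι → ℕ) (hf : ∀ i ∈ s, f i ≠ 0) :
    ordAt z (∏ i ∈ s, f i ^ n i) = ∑ i ∈ s, n i * ordAt z (f i) := by
  classical
  induction s using Finset.induction_on with
  | empty => simp [ordAt_one]
  | insert a s ha ih =>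
    rw [Finset.prod_insert ha, Finset.sum_insert ha, ordAt_mul, ordAt_pow,
      ih fun i hi => hf i (Finset.mem_insert_of_mem hi)]
    · exact pow_ne_zero _ (hf a (Finset.mem_insert_self a s))
    · exact Finset.prod_ne_zero_iff.2 fun i hi =>
        pow_ne_zero _ (hf i (Finset.mem_insert_of_mem hi))

theorem ordAt_nonneg_iff (z : HeightOneSpectrum A₀) {f : K} (hf : f ≠ 0) :
    0 ≤ ordAt z f ↔ z.valuation K f ≤ 1 := by
  simpa using neg_le_ordAt_iff z hf 0

theorem natCast_le_ordAt_iff (z : HeightOneSpectrum A₀) {a : A₀} (ha : a ≠ 0) (n : ℕ) :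
    (n : ℤ) ≤ ordAt z (algebraMap A₀ K a) ↔ a ∈ z.asIdeal ^ n := by
  have h0 : algebraMap A₀ K a ≠ 0 := by simpa using ha
  have := neg_le_ordAt_iff z h0 (-n)
  rw [neg_neg] at this
  rw [this, HeightOneSpectrum.valuation_of_algebraMap,
    HeightOneSpectrum.intValuation_le_pow_iff_mem]

theorem ordAt_algebraMap_nonneg (z : HeightOneSpectrum A₀) {a : A₀} (ha : a ≠ 0) :
    0 ≤ ordAt z (algebraMap A₀ K a) :=
  (ordAt_nonneg_iff z (by simpa using ha)).2 (z.valuation_le_one a)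

theorem finite_ordAt_algebraMap_ne_zero {a : A₀} (ha : a ≠ 0) :
    {z : HeightOneSpectrum A₀ | ordAt z (algebraMap A₀ K a) ≠ 0}.Finite := by
  refine (Ideal.finite_factors (I := Ideal.span {a}) (by simpa using ha)).subset fun z hz => ?_
  have h1 : ((1 : ℕ) : ℤ) ≤ ordAt z (algebraMap A₀ K a) := by
    have h2 := ordAt_algebraMap_nonneg (K := K) z ha
    have h3 : ordAt z (algebraMap A₀ K a) ≠ 0 := hz
    omega
  rw [natCast_le_ordAt_iff z ha, pow_one] at h1
  exact Ideal.dvd_span_singleton.2 h1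

theorem finite_ordAt_ne_zero {f : K} (hf : f ≠ 0) :
    {z : HeightOneSpectrum A₀ | ordAt z f ≠ 0}.Finite := by
  obtain ⟨a, b, hb, rfl⟩ := IsFractionRing.div_surjective (A := A₀) f
  have hb0 := nonZeroDivisors.ne_zero hb
  have ha0 : a ≠ 0 := by
    rintro rfl
    simp at hf
  refine ((finite_ordAt_algebraMap_ne_zero (K := K) ha0).union
    (finite_ordAt_algebraMap_ne_zero (K := K) hb0)).subset fun z hz => ?_
  by_contra h
  simp only [Set.mem_union, Set.mem_ofPred_eq, not_or, not_not] at h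
  refine hz ?_
  rw [ordAt_div z (by simpa using ha0) (by simpa using hb0), h.1, h.2, sub_zero]

/-- Membership in a nonzero fractional ideal is detected by the orders of vanishing. -/
theorem mem_span_of_forall_exists_ordAt_le {s : Set K} (hs : ∃ g ∈ s, g ≠ 0) {x : K} (hx : x ≠ 0)
    (h : ∀ z : HeightOneSpectrum A₀, ∃ g ∈ s, g ≠ 0 ∧ ordAt z g ≤ ordAt z x) :
    x ∈ Submodule.span A₀ s := by
  -- The ideal of those `a` with `a • x` in the span contains every denominator of `x / g`. If it
  -- were proper it would lie in a maximal `P`, but for suitable `g` some denominator avoids `P`;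
  -- the case `P = ⊥` is that of a field `A₀`.
  let I : Ideal A₀ := (Submodule.span A₀ s).comap (LinearMap.toSpanSingleton A₀ K x)
  have hI : ∀ a, a ∈ I ↔ a • x ∈ Submodule.span A₀ s := fun a => Iff.rfl
  have key : ∀ g ∈ s, g ≠ 0 → ∀ d n : A₀, x / g * algebraMap A₀ K d = algebraMap A₀ K n →
      d ∈ I := by
    intro g hg hg0 d n hdn
    rw [hI]
    have : d • x = n • g := by
      rw [Algebra.smul_def, Algebra.smul_def, ← hdn]
      field_simp
    rw [this]
    exact Submodule.smul_mem _ _ (Submodule.subset_span hg)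
  by_contra hnot
  have hIne : I ≠ ⊤ := fun htop => hnot (by
    have : (1 : A₀) ∈ I := htop ▸ Submodule.mem_top
    rwa [hI, one_smul] at this)
  obtain ⟨P, hP, hIP⟩ := Ideal.exists_le_maximal I hIne
  by_cases hP0 : P = ⊥
  · obtain ⟨g, hg, hg0⟩ := hs
    obtain ⟨n, d, hd, hnd⟩ := IsFractionRing.div_surjective (A := A₀) (x / g)
    have hd0 := nonZeroDivisors.ne_zero hd
    have := hIP (key g hg hg0 d n (by
      rw [← hnd, div_mul_cancel₀]
      simpa using hd0))
    rw [hP0, Ideal.mem_bot] at this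
    exact hd0 this
  · let z : HeightOneSpectrum A₀ := ⟨P, hP.isPrime, hP0⟩
    obtain ⟨g, hg, hg0, hle⟩ := h z
    obtain ⟨n, d, hnd⟩ := HeightOneSpectrum.exists_primeCompl_mul_eq_of_integer (K := K) z (x / g)
      ((ordAt_nonneg_iff z (div_ne_zero hx hg0)).1 (by rw [ordAt_div z hx hg0]; linarith))
    exact d.2 (hIP (key g hg hg0 d n hnd))

/-- There is an element of `A₀` which vanishes to prescribed order at least at every point, and
exactly at a given point. -/
theorem exists_ordAt_algebraMap_eq (E : HeightOneSpectrum A₀ →₀ ℕ) (z₀ : HeightOneSpectrum A₀) :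
    ∃ a : A₀, a ≠ 0 ∧ (∀ z, (E z : ℤ) ≤ ordAt z (algebraMap A₀ K a)) ∧
      ordAt z₀ (algebraMap A₀ K a) = E z₀ := by
  classical
  obtain ⟨c, hc, hc'⟩ := SetLike.exists_of_lt
    (Ideal.pow_right_strictAnti z₀.asIdeal z₀.ne_bot z₀.isPrime.ne_top (Nat.lt_succ_self (E z₀)))
  -- The extra power at `z₀` makes the congruence with `c`, which has order exactly `E z₀`, fix the
  -- order of `y` there.
  let e : HeightOneSpectrum A₀ → ℕ := fun z => if z = z₀ then E z₀ + 1 else E z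
  obtain ⟨y, hy⟩ := IsDedekindDomain.exists_forall_sub_mem_ideal
    (s := insert z₀ E.support) (fun z : HeightOneSpectrum A₀ => z.asIdeal) e
    (fun z _ => z.prime) (fun z _ w _ hzw h => hzw (HeightOneSpectrum.ext h))
    (fun z => if (z : HeightOneSpectrum A₀) = z₀ then c else 0)
  have hy₀ : y - c ∈ z₀.asIdeal ^ (E z₀ + 1) := by
    have := hy z₀ (Finset.mem_insert_self _ _)
    simpa only [e, if_true] using this
  have hyz : ∀ z, y ∈ z.asIdeal ^ E z := by
    intro z
    by_cases hz : z = z₀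
    · subst hz
      have := Ideal.add_mem _ (Ideal.pow_le_pow_right (Nat.le_succ _) hy₀) hc
      rwa [sub_add_cancel] at this
    · by_cases hzE : z ∈ E.support
      · have := hy z (Finset.mem_insert_of_mem hzE)
        simpa only [e, hz, if_false, sub_zero] using this
      · rw [Finsupp.notMem_support_iff.1 hzE, pow_zero, Ideal.one_eq_top]
        exact Submodule.mem_top
  have hy₀' : y ∉ z₀.asIdeal ^ (E z₀ + 1) := fun h => hc' (by
    have := Ideal.sub_mem _ h hy₀
    rwa [sub_sub_cancel] at this)
  have hne : y ≠ 0 := by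
    rintro rfl
    exact hy₀' (Ideal.zero_mem _)
  refine ⟨y, hne, fun z => (natCast_le_ordAt_iff z hne _).2 (hyz z), ?_⟩
  have h1 := (natCast_le_ordAt_iff (K := K) z₀ hne _).2 (hyz z₀)
  have h2 := mt (natCast_le_ordAt_iff (K := K) z₀ hne _).1 hy₀'
  push_cast at h2
  omega

/-- The sheaf `O(D)` on an affine Dedekind scheme is globally generated. -/
theorem exists_mem_globalSections_ordAt_eq (D : HeightOneSpectrum A₀ →₀ ℤ)
    (z₀ : HeightOneSpectrum A₀) :
    ∃ f ∈ globalSections K D, f ≠ 0 ∧ ordAt z₀ f = -D z₀ := by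
  classical
  obtain ⟨d, hd0, hd, -⟩ := exists_ordAt_algebraMap_eq (K := K)
    (D.mapRange Int.toNat Int.toNat_zero) z₀
  have hdD : ∀ z, D z ≤ ordAt z (algebraMap A₀ K d) := fun z =>
    (Int.self_le_toNat (D z)).trans (by simpa using hd z)
  have hdK : algebraMap A₀ K d ≠ 0 := by simpa using hd0
  -- The divisor `div d - D` is effective, so an `a` vanishing along it, exactly at `z₀`, gives the
  -- section `a / d`.
  let E : HeightOneSpectrum A₀ →₀ ℕ := Finsupp.ofSupportFinite
    (fun z => (ordAt z (algebraMap A₀ K d) - D z).toNat)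
    (((finite_ordAt_algebraMap_ne_zero (K := K) hd0).union D.hasFiniteSupport).subset fun z hz => by
      by_contra h
      simp only [Set.mem_union, Set.mem_ofPred_eq, not_or, not_not, Function.mem_support] at h
      exact hz (by simp [h.1, h.2]))
  have hE : ∀ z, (E z : ℤ) = ordAt z (algebraMap A₀ K d) - D z := fun z =>
    Int.toNat_of_nonneg (sub_nonneg.2 (hdD z))
  obtain ⟨a, ha0, ha, haz⟩ := exists_ordAt_algebraMap_eq (K := K) E z₀
  have haK : algebraMap A₀ K a ≠ 0 := by simpa using ha0
  refine ⟨algebraMap A₀ K a / algebraMap A₀ K d, fun _ z => ?_, div_ne_zero haK hdK, ?_⟩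
  · rw [ordAt_div z haK hdK]
    linarith [ha z, hE z]
  · rw [ordAt_div z₀ haK hdK, haz, hE]
    ring

theorem exists_mem_globalSections_ne_zero (D : HeightOneSpectrum A₀ →₀ ℤ) :
    ∃ f ∈ globalSections K D, f ≠ 0 := by
  -- Without closed points (`A₀` a field) every element is a section.
  rcases isEmpty_or_nonempty (HeightOneSpectrum A₀) with h | ⟨⟨z⟩⟩
  · exact ⟨1, fun _ z => (h.false z).elim, one_ne_zero⟩
  · obtain ⟨f, hf, hf0, -⟩ := exists_mem_globalSections_ordAt_eq (K := K) D z
    exact ⟨f, hf, hf0⟩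

theorem le_of_globalSections_le {D D' : HeightOneSpectrum A₀ →₀ ℤ}
    (h : globalSections K D ≤ globalSections K D') (z : HeightOneSpectrum A₀) : D z ≤ D' z := by
  obtain ⟨f, hf, hf0, hfz⟩ := exists_mem_globalSections_ordAt_eq (K := K) D z
  linarith [h hf hf0 z]

/-- One nonzero section `g` generates `O(D)` wherever both `D` and `div g` vanish; at each of the
finitely many other points, add a section of exact order. -/
theorem globalSections_fg (D : HeightOneSpectrum A₀ →₀ ℤ) : (globalSections K D).FG := by
  classical
  obtain ⟨g, hg, hg0⟩ := exists_mem_globalSections_ne_zero (K := K) D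
  choose f hf hf0 hfz using exists_mem_globalSections_ordAt_eq (K := K) D
  let F : Set (HeightOneSpectrum A₀) := {z | ordAt z g ≠ 0} ∪ Function.support D
  have hF : F.Finite := (finite_ordAt_ne_zero hg0).union D.hasFiniteSupport
  have hs : (insert g (f '' F)).Finite := (hF.image f).insert g
  refine Submodule.fg_def.2 ⟨_, hs, le_antisymm (Submodule.span_le.2 ?_) fun x hx => ?_⟩
  · rintro _ (rfl | ⟨z, -, rfl⟩)
    · exact hg
    · exact hf z
  · by_cases hx0 : x = 0
    · rw [hx0]
      exact Submodule.zero_mem _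
    · refine mem_span_of_forall_exists_ordAt_le ⟨g, Set.mem_insert _ _, hg0⟩ hx0 fun z => ?_
      by_cases hz : z ∈ F
      · refine ⟨f z, Set.mem_insert_of_mem _ ⟨z, hz, rfl⟩, hf0 z, ?_⟩
        linarith [hfz z, hx hx0 z]
      · simp only [F, Set.mem_union, Set.mem_ofPred_eq, not_or, not_not,
          Function.mem_support] at hz
        refine ⟨g, Set.mem_insert _ _, hg0, ?_⟩
        linarith [hx hx0 z]

/-- Products of sections of exact orders `-D z` and `-D' z` generate `O(D + D')` at `z`, and
membership in a fractional ideal is local. -/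
theorem globalSections_add_le (D D' : HeightOneSpectrum A₀ →₀ ℤ) :
    globalSections K (D + D') ≤ globalSections K D * globalSections K D' := by
  intro x hx
  by_cases hx0 : x = 0
  · rw [hx0]
    exact Submodule.zero_mem _
  obtain ⟨f, hf, hf0⟩ := exists_mem_globalSections_ne_zero (K := K) D
  obtain ⟨g, hg, hg0⟩ := exists_mem_globalSections_ne_zero (K := K) D'
  rw [← Submodule.span_eq (globalSections K D * globalSections K D')]
  refine mem_span_of_forall_exists_ordAt_le
    ⟨f * g, Submodule.mul_mem_mul hf hg, mul_ne_zero hf0 hg0⟩ hx0 fun z => ?_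
  obtain ⟨f, hf, hf0, hfz⟩ := exists_mem_globalSections_ordAt_eq (K := K) D z
  obtain ⟨g, hg, hg0, hgz⟩ := exists_mem_globalSections_ordAt_eq (K := K) D' z
  refine ⟨f * g, Submodule.mul_mem_mul hf hg, mul_ne_zero hf0 hg0, ?_⟩
  have := hx hx0 z
  rw [Finsupp.add_apply] at this
  rw [ordAt_mul z hf0 hg0]
  linarith

theorem mem_range_algebraMap_of_ordAt_nonneg {f : K}
    (h : f ≠ 0 → ∀ z : HeightOneSpectrum A₀, 0 ≤ ordAt z f) : f ∈ (algebraMap A₀ K).range := by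
  by_cases hf : f = 0
  · rw [hf]
    exact Subring.zero_mem _
  · exact HeightOneSpectrum.mem_integers_of_valuation_le_one K f fun z =>
      (ordAt_nonneg_iff z hf).1 (h hf z)

end DedekindOrder

/-! ### Normality and leading terms in the group algebra of a lattice. -/

section GroupAlgebra

namespace AddMonoidAlgebra

variable {K G : Type*} [Field K] [AddCommGroup G]

instance instIsDomainOfFree [Module.Free ℤ G] [Module.Finite ℤ G] :
    IsDomain (AddMonoidAlgebra K G) := by
  let e := (Module.finBasis ℤ G).equivFun
  have : UniqueSums G := UniqueSums.of_injective_addHom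
    (H := G) (G := Fin (Module.finrank ℤ G) → ℤ)
    ⟨e, map_add e⟩ e.injective inferInstance
  exact NoZeroDivisors.to_isDomain _

/-- The inclusion of the free monoid on a basis of a lattice. -/
noncomputable def latticeOfNat {n : ℕ} (b : Module.Basis (Fin n) ℤ G) : (Fin n →₀ ℕ) →+ G :=
  b.repr.symm.toAddEquiv.toAddMonoidHom.comp
    (Finsupp.mapRange.addMonoidHom (Nat.castAddMonoidHom ℤ))

theorem latticeOfNat_injective {n : ℕ} (b : Module.Basis (Fin n) ℤ G) :
    Function.Injective (latticeOfNat b) :=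
  b.repr.symm.injective.comp
    (Finsupp.mapRange_injective (Nat.castAddMonoidHom ℤ) (map_zero _) Nat.cast_injective)

theorem exists_latticeOfNat_add {n : ℕ} (b : Module.Basis (Fin n) ℤ G) (g : G) :
    ∃ p q, g + latticeOfNat b q = latticeOfNat b p := by
  refine ⟨(b.repr g).mapRange Int.toNat rfl, (b.repr (-g)).mapRange Int.toNat rfl, ?_⟩
  apply b.repr.injective
  ext i
  simp only [latticeOfNat, map_add, map_neg, AddMonoidHom.comp_apply, Finsupp.add_apply]
  have h : ∀ x : Fin n →₀ ℤ, b.repr (b.repr.symm.toAddEquiv.toAddMonoidHom x) = x :=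
    b.repr.apply_symm_apply
  rw [h, h]
  simp only [Finsupp.mapRange.addMonoidHom_apply, Finsupp.mapRange_apply, Finsupp.neg_apply,
    Nat.coe_castAddMonoidHom]
  omega

/-- The group algebra of a lattice over a field is normal. -/
theorem isIntegrallyClosed_of_free [Module.Free ℤ G] [Module.Finite ℤ G] :
    IsIntegrallyClosed (AddMonoidAlgebra K G) := by
  let b := Module.finBasis ℤ G
  let R := AddMonoidAlgebra K (Fin (Module.finrank ℤ G) →₀ ℕ)
  let φ : R →+* AddMonoidAlgebra K G := mapDomainRingHom K (latticeOfNat b)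
  let _ : Algebra R (AddMonoidAlgebra K G) := φ.toAlgebra
  have hφ : ∀ x, algebraMap R (AddMonoidAlgebra K G) x = mapDomain (latticeOfNat b) x :=
    fun _ => rfl
  have hφs : ∀ (s : Fin (Module.finrank ℤ G) →₀ ℕ) (c : K),
      algebraMap R (AddMonoidAlgebra K G) (single s c) = single (latticeOfNat b s) c :=
    fun s c => by rw [hφ, mapDomain_single]
  have : UniqueFactorizationMonoid R :=
    inferInstanceAs (UniqueFactorizationMonoid (MvPolynomial (Fin (Module.finrank ℤ G)) K))
  have : IsDomain R := inferInstanceAs (IsDomain (MvPolynomial (Fin (Module.finrank ℤ G)) K))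
  have : IsIntegrallyClosed R := UniqueFactorizationMonoid.instIsIntegrallyClosed
  let S : Submonoid R := MonoidHom.mrange (of K (Fin (Module.finrank ℤ G) →₀ ℕ))
  have hS0 : S ≤ nonZeroDivisors R := by
    rintro _ ⟨s, rfl⟩
    rw [mem_nonZeroDivisors_iff_ne_zero]
    exact single_ne_zero.2 one_ne_zero
  -- `K[G]` is the polynomial ring, a unique factorization domain, with the monomials inverted.
  have : IsLocalization S (AddMonoidAlgebra K G) := by
    refine (isLocalization_iff _ _).2 ⟨?_, ?_, ?_⟩
    · rintro ⟨_, s, rfl⟩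
      refine IsUnit.of_mul_eq_one (single (-latticeOfNat b s.toAdd) (1 : K)) ?_
      change algebraMap R (AddMonoidAlgebra K G) (single s.toAdd 1) * _ = 1
      rw [hφs, single_mul_single, add_neg_cancel, mul_one]
      rfl
    · intro a
      induction a using AddMonoidAlgebra.induction_linear with
      | zero => exact ⟨(0, 1), by simp⟩
      | add x y hx hy =>
        obtain ⟨⟨p, s⟩, hp⟩ := hx
        obtain ⟨⟨q, t⟩, hq⟩ := hy
        refine ⟨(p * t + q * s, s * t), ?_⟩
        simp only [Submonoid.coe_mul, map_mul, map_add] at hp hq ⊢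
        rw [← hp, ← hq]
        ring
      | single g c =>
        obtain ⟨p, q, hpq⟩ := exists_latticeOfNat_add b g
        refine ⟨(single p c, ⟨_, Multiplicative.ofAdd q, rfl⟩), ?_⟩
        change _ * algebraMap R (AddMonoidAlgebra K G) (single q 1) =
          algebraMap R (AddMonoidAlgebra K G) (single p c)
        rw [hφs, hφs, single_mul_single, mul_one, hpq]
    · intro x y hxy
      exact ⟨1, by rw [mapDomain_injective (latticeOfNat_injective b) hxy]⟩
  exact isIntegrallyClosed_of_isLocalization _ S hS0

section Leading

variable {Γ : Type*} [AddCommGroup Γ] [LinearOrder Γ] [IsOrderedAddMonoid Γ] {D : G →+ Γ}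

/-- For an injective map to an ordered group, no pair of exponents other than `(l, k)` can reach the
largest sum, so leading terms multiply without cancellation. -/
theorem coeff_mul_of_isGreatest (hD : Function.Injective D) {x y : AddMonoidAlgebra K G} {l k : G}
    (hx : ∀ i ∈ x.coeff.support, D i ≤ D l) (hy : ∀ i ∈ y.coeff.support, D i ≤ D k) :
    (∀ i ∈ (x * y).coeff.support, D i ≤ D (l + k)) ∧
      (x * y).coeff (l + k) = x.coeff l * y.coeff k := by
  classical
  constructor
  · intro i hi
    obtain ⟨p, hp, q, hq, rfl⟩ := Finset.mem_add.1 (support_coeff_mul_subset x y hi)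
    rw [map_add, map_add]
    exact add_le_add (hx p hp) (hy q hq)
  · refine coeff_mul_add_of_uniqueAdd fun p q hp hq h => ?_
    have h1 := hx p hp
    have h2 := hy q hq
    have h3 : D p + D q = D l + D k := by rw [← map_add, h, map_add]
    have h4 : D p = D l := le_antisymm h1 (by
      by_contra! hlt
      exact absurd h3 (add_lt_add_of_lt_of_le hlt h2).ne)
    rw [h4, add_right_inj] at h3
    exact ⟨hD h4, hD h3⟩

theorem coeff_mul_pow_of_isGreatest (hD : Function.Injective D) {x y : AddMonoidAlgebra K G}
    {l k : G} (hx : ∀ i ∈ x.coeff.support, D i ≤ D l) (hy : ∀ i ∈ y.coeff.support, D i ≤ D k)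
    (n : ℕ) :
    (∀ i ∈ (x * y ^ n).coeff.support, D i ≤ D (l + n • k)) ∧
      (x * y ^ n).coeff (l + n • k) = x.coeff l * y.coeff k ^ n := by
  induction n with
  | zero => simpa using hx
  | succ n ih =>
    have := coeff_mul_of_isGreatest hD ih.1 hy
    rw [ih.2] at this
    rwa [pow_succ, ← mul_assoc, succ_nsmul, ← add_assoc, pow_succ, ← mul_assoc]

end Leading

/-- A graded subring of the group algebra of a lattice contains its almost integral elements as
soon as it contains the homogeneous ones. -/
theorem mem_of_forall_mul_pow_mem [Module.Free ℤ G] [Module.Finite ℤ G]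
    (B : Subring (AddMonoidAlgebra K G))
    (hB : ∀ a ∈ B, ∀ m, single m (a.coeff m) ∈ B)
    (hclosed : ∀ (l m : G) (g f : K), g ≠ 0 →
      (∀ n : ℕ, single (l + n • m) (g * f ^ n) ∈ B) → single m f ∈ B)
    {d : AddMonoidAlgebra K G} (hd : d ≠ 0) (a : AddMonoidAlgebra K G)
    (ha : ∀ n : ℕ, d * a ^ n ∈ B) : a ∈ B := by
  classical
  -- A total group order on the lattice, used to pick leading terms.
  let D : G →+ Lex (Fin (Module.finrank ℤ G) → ℤ) :=
    { toFun := fun g => toLex ((Module.finBasis ℤ G).equivFun g)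
      map_zero' := by rw [map_zero]; rfl
      map_add' := fun x y => by rw [map_add]; rfl }
  have hD : Function.Injective D := (toLex.injective).comp (Module.finBasis ℤ G).equivFun.injective
  have hgreatest : ∀ x : AddMonoidAlgebra K G, x ≠ 0 →
      ∃ l ∈ x.coeff.support, ∀ i ∈ x.coeff.support, D i ≤ D l := fun x hx =>
    Finset.exists_max_image _ D (Finsupp.support_nonempty_iff.2 (by simpa using hx))
  obtain ⟨l, hl, hlmax⟩ := hgreatest d hd
  induction hc : a.coeff.support.card using Nat.strong_induction_on generalizing a with
  | _ c ih =>
    by_cases ha0 : a = 0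
    · rw [ha0]
      exact B.zero_mem
    obtain ⟨m, hm, hmmax⟩ := hgreatest a ha0
    have hs : single m (a.coeff m) ∈ B := by
      refine hclosed l m (d.coeff l) _ (Finsupp.mem_support_iff.1 hl) fun n => ?_
      rw [← (coeff_mul_pow_of_isGreatest hD hlmax hmmax n).2]
      exact hB _ (ha n) _
    have herase : a.erase m = a + -single m (a.coeff m) := by
      rw [eq_add_neg_iff_add_eq, erase_add_single]
    have hrec : a.erase m ∈ B := by
      refine ih _ ?_ (a.erase m) (fun n => ?_) rfl
      · rw [← hc, coeff_erase, Finsupp.support_erase]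
        exact Finset.card_erase_lt_of_mem hm
      -- Removing the leading term `s ∈ B` keeps the hypothesis: `d * (a - s) ^ n` expands into
      -- terms `d * a ^ i` times elements of `B`.
      · rw [herase, add_pow, Finset.mul_sum]
        refine B.sum_mem fun i _ => ?_
        rw [← mul_assoc, ← mul_assoc]
        exact B.mul_mem (B.mul_mem (ha i) (B.pow_mem (B.neg_mem hs) _)) (natCast_mem B _)
    rw [← single_add_erase m a]
    exact B.add_mem hs hrec

end AddMonoidAlgebra

end GroupAlgebra

/-! ### Fraction fields and normality of graded subalgebras. -/

section GradedSubalgebra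

open AddMonoidAlgebra

variable {A₀ : Type*} [CommRing A₀] {K : Type*} [Field K] [Algebra A₀ K]
  {N : Type*} [AddCommGroup N]

theorem mem_gradedPiece {A : Subalgebra A₀ (AddMonoidAlgebra K (DualLattice N))}
    {m : DualLattice N} {f : K} : f ∈ gradedPiece A m ↔ single m f ∈ A := Iff.rfl

theorem mem_of_forall_single_mem {A : Subalgebra A₀ (AddMonoidAlgebra K (DualLattice N))}
    {a : AddMonoidAlgebra K (DualLattice N)} (h : ∀ m, single m (a.coeff m) ∈ A) : a ∈ A := by
  rw [← sum_coeff_single a]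
  exact A.sum_mem fun m _ => h m

theorem algebraMap_eq_single (c : A₀) :
    algebraMap A₀ (AddMonoidAlgebra K (DualLattice N)) c = single 0 (algebraMap A₀ K c) := rfl

theorem exists_ne_zero_of_gradedPiece_ne_bot
    {A : Subalgebra A₀ (AddMonoidAlgebra K (DualLattice N))} {m : DualLattice N}
    (h : gradedPiece A m ≠ ⊥) : ∃ f ≠ 0, single m f ∈ A := by
  obtain ⟨f, hf, hf0⟩ := Submodule.exists_mem_ne_zero_of_ne_bot h
  exact ⟨f, hf0, hf⟩

theorem gradedPiece_ne_bot {A : Subalgebra A₀ (AddMonoidAlgebra K (DualLattice N))}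
    {m : DualLattice N} {f : K} (hf : f ≠ 0) (h : single m f ∈ A) : gradedPiece A m ≠ ⊥ :=
  fun hbot => hf (by
    have : f ∈ gradedPiece A m := h
    rwa [hbot, Submodule.mem_bot] at this)

/-- If `A` has the fraction field of `K[M]`, then its weights do not lie in a proper subgroup. -/
theorem mem_of_hasFullFractionField {A : Subalgebra A₀ (AddMonoidAlgebra K (DualLattice N))}
    (h : HasFullFractionField A) (H : AddSubgroup (DualLattice N))
    (hH : ∀ a ∈ A, ∀ m, a.coeff m ≠ 0 → m ∈ H) (m : DualLattice N) : m ∈ H := by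
  classical
  let L := FractionRing (AddMonoidAlgebra K (DualLattice N))
  have : IsFractionRing A L := h
  have hinj : Function.Injective (algebraMap (AddMonoidAlgebra K (DualLattice N)) L) :=
    IsFractionRing.injective _ _
  obtain ⟨⟨p, q⟩, hpq⟩ := IsLocalization.surj (nonZeroDivisors A)
    (algebraMap (AddMonoidAlgebra K (DualLattice N)) L (single m 1))
  have hmul : single m 1 * ((q : A) : AddMonoidAlgebra K (DualLattice N)) =
      (p : AddMonoidAlgebra K (DualLattice N)) := by
    apply hinj
    rw [map_mul]
    exact hpq
  have hq0 : ((q : A) : AddMonoidAlgebra K (DualLattice N)) ≠ 0 := by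
    simp
  -- With `χ^m = p / q`, any weight `k` of `q` gives the weight `m + k` of `p`, and `m` is their
  -- difference.
  obtain ⟨k, hk⟩ : ∃ k, ((q : A) : AddMonoidAlgebra K (DualLattice N)).coeff k ≠ 0 := by
    by_contra! hcon
    exact hq0 (by ext k; simpa using hcon k)
  have hpk : (p : AddMonoidAlgebra K (DualLattice N)).coeff (m + k) ≠ 0 := by
    rw [← hmul, coeff_single_mul_eq_mul_coeff k (fun j _ => add_right_inj m), one_mul]
    exact hk
  have := H.sub_mem (hH _ p.2 _ hpk) (hH _ (q : A).2 _ hk)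
  rwa [add_sub_cancel_right] at this

variable [Module.Free ℤ N] [Module.Finite ℤ N]

/-- A subalgebra of `K[M]` whose weights generate `M` has the fraction field of `K[M]`. -/
theorem hasFullFractionField_of_closure_eq_top [IsDomain A₀] [IsFractionRing A₀ K]
    (A : Subalgebra A₀ (AddMonoidAlgebra K (DualLattice N)))
    (h : AddSubgroup.closure {m | gradedPiece A m ≠ ⊥} = ⊤) : HasFullFractionField A := by
  let L := FractionRing (AddMonoidAlgebra K (DualLattice N))
  let φ : AddMonoidAlgebra K (DualLattice N) →+* L := algebraMap _ _
  have hφ : Function.Injective φ := IsFractionRing.injective _ _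
  have : FaithfulSMul A L := by
    rw [faithfulSMul_iff_algebraMap_injective]
    exact hφ.comp Subtype.val_injective
  let F : Subfield L := Subfield.closure (Set.range (algebraMap A L))
  have hA : ∀ a ∈ A, φ a ∈ F := fun a ha => Subfield.subset_closure ⟨⟨a, ha⟩, rfl⟩
  have hK : ∀ c : K, φ (single 0 c) ∈ F := by
    intro c
    obtain ⟨a, b, hb, rfl⟩ := IsFractionRing.div_surjective (A := A₀) c
    have hb0 : algebraMap A₀ K b ≠ 0 := by
      simpa using nonZeroDivisors.ne_zero hb
    have hb1 : φ (single 0 (algebraMap A₀ K b)) ≠ 0 := by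
      rw [Ne, map_eq_zero_iff φ hφ]
      exact single_ne_zero.2 hb0
    have : φ (single 0 (algebraMap A₀ K a / algebraMap A₀ K b)) =
        φ (single 0 (algebraMap A₀ K a)) / φ (single 0 (algebraMap A₀ K b)) := by
      rw [eq_div_iff hb1, ← map_mul, single_mul_single, add_zero, div_mul_cancel₀ _ hb0]
    rw [this]
    exact F.div_mem (hA _ (A.algebraMap_mem a)) (hA _ (A.algebraMap_mem b))
  have hinv : ∀ m : DualLattice N, φ (single (-m) 1) = (φ (single m 1))⁻¹ := by
    intro m
    refine eq_inv_of_mul_eq_one_left ?_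
    rw [← map_mul, single_mul_single, neg_add_cancel, mul_one]
    exact map_one φ
  let H : AddSubgroup (DualLattice N) :=
    { carrier := {m | φ (single m 1) ∈ F}
      zero_mem' := hK 1
      add_mem' := fun {m m'} hm hm' => by
        have : φ (single (m + m') 1) = φ (single m 1) * φ (single m' 1) := by
          rw [← map_mul, single_mul_single, mul_one]
        change φ (single (m + m') 1) ∈ F
        rw [this]
        exact F.mul_mem hm hm'
      neg_mem' := fun {m} hm => by
        change φ (single (-m) 1) ∈ F
        rw [hinv]
        exact F.inv_mem hm }
  have hH : ∀ m, m ∈ H := by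
    have : AddSubgroup.closure {m | gradedPiece A m ≠ ⊥} ≤ H := by
      refine (AddSubgroup.closure_le H).2 fun m hm => ?_
      obtain ⟨f, hf0, hf⟩ := exists_ne_zero_of_gradedPiece_ne_bot hm
      have : φ (single m 1) = φ (single m f) * φ (single 0 f⁻¹) := by
        rw [← map_mul, single_mul_single, add_zero, mul_inv_cancel₀ hf0]
      change φ (single m 1) ∈ F
      rw [this]
      exact F.mul_mem (hA _ hf) (hK _)
    rw [h] at this
    exact fun m => this (AddSubgroup.mem_top m)
  have hall : ∀ a, φ a ∈ F := by
    intro a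
    induction a using AddMonoidAlgebra.induction_linear with
    | zero => rw [map_zero]; exact F.zero_mem
    | add x y hx hy => rw [map_add]; exact F.add_mem hx hy
    | single m c =>
      have : φ (single m c) = φ (single 0 c) * φ (single m 1) := by
        rw [← map_mul, single_mul_single, zero_add, mul_one]
      rw [this]
      exact F.mul_mem (hK c) (hH m)
  refine IsFractionRing.of_field A L fun x => ?_
  have hx : x ∈ F := by
    obtain ⟨a, b, -, rfl⟩ :=
      IsFractionRing.div_surjective (A := AddMonoidAlgebra K (DualLattice N)) x
    exact F.div_mem (hall a) (hall b)
  obtain ⟨y, hy, z, hz, rfl⟩ := Subfield.mem_closure_iff.1 hx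
  have hcl : Subring.closure (Set.range (algebraMap A L)) ≤ (algebraMap A L).range :=
    Subring.closure_le.2 fun _ h => h
  obtain ⟨y, rfl⟩ := hcl hy
  obtain ⟨z, rfl⟩ := hcl hz
  exact ⟨y, z, rfl⟩

/-- A graded subalgebra of `K[M]` with the fraction field of `K[M]` is normal as soon as it
contains the homogeneous elements which are almost integral over it. -/
theorem isIntegrallyClosed_of_homogeneous
    {A : Subalgebra A₀ (AddMonoidAlgebra K (DualLattice N))}
    (hA : IsGradedSubalgebra A) (hfull : HasFullFractionField A)
    (hclosed : ∀ (l m : DualLattice N) (g f : K), g ≠ 0 →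
      (∀ n : ℕ, single (l + n • m) (g * f ^ n) ∈ A) → single m f ∈ A) :
    IsIntegrallyClosed A := by
  let L := FractionRing (AddMonoidAlgebra K (DualLattice N))
  have : IsFractionRing A L := hfull
  have : IsIntegrallyClosed (AddMonoidAlgebra K (DualLattice N)) := isIntegrallyClosed_of_free
  have hinj : Function.Injective (algebraMap (AddMonoidAlgebra K (DualLattice N)) L) :=
    IsFractionRing.injective _ _
  refine (isIntegrallyClosed_iff L).2 fun {x} hx => ?_
  have hx' : IsIntegral (AddMonoidAlgebra K (DualLattice N)) x := hx.tower_top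
  obtain ⟨a, rfl⟩ := (isIntegrallyClosed_iff L).1 this hx'
  -- Integral elements already lie in the normal ring `K[M]`; almost integrality supplies the `d`
  -- with `d * a ^ n ∈ A` for all `n`.
  obtain ⟨d, hd, hda⟩ := hx.isAlmostIntegral
  have hd0 : (d : AddMonoidAlgebra K (DualLattice N)) ≠ 0 := by
    simpa using nonZeroDivisors.ne_zero hd
  have ha : a ∈ A.toSubring := mem_of_forall_mul_pow_mem A.toSubring hA hclosed hd0 a fun n => by
    obtain ⟨y, hy⟩ := hda n
    have : (y : AddMonoidAlgebra K (DualLattice N)) = d * a ^ n := by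
      apply hinj
      rw [map_mul, map_pow]
      refine Eq.trans hy ?_
      rw [Algebra.smul_def]
      rfl
    rw [← this]
    exact y.2
  exact ⟨⟨a, ha⟩, rfl⟩

end GradedSubalgebra

/-! ### Homogeneous generators from Hilbert's basis theorem. -/

section FiniteGeneration

open AddMonoidAlgebra

variable {A₀ : Type*} [CommRing A₀] {K : Type*} [Field K] [Algebra A₀ K]
  {N : Type*} [AddCommGroup N] [Module.Free ℤ N] [Module.Finite ℤ N]

/-- A noetherian graded subalgebra of `K[M]` is generated, over its part of degree zero, by
finitely many homogeneous elements. -/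
theorem exists_adjoin_eq_of_isNoetherianRing
    {A : Subalgebra A₀ (AddMonoidAlgebra K (DualLattice N))} (hA : IsGradedSubalgebra A)
    (h0 : gradedPiece A 0 = 1) [IsNoetherianRing A] :
    ∃ (r : ℕ) (f : Fin r → K) (m : Fin r → DualLattice N), (∀ i, f i ≠ 0) ∧ (∀ i, m i ≠ 0) ∧
      A = Algebra.adjoin A₀ (Set.range fun i => single (m i) (f i)) := by
  classical
  let b := Module.finBasis ℤ (DualLattice N)
  let ι := Fin (Module.finrank ℤ (DualLattice N))
  -- `s m` records the positive and negative parts of the coordinates. If `s m' ≤ s m`, then no sign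
  -- cancellation occurs in `(m - m') + m'`, so the norm `w` is additive there.
  let s : DualLattice N → (ι ⊕ ι →₀ ℕ) := fun m => Finsupp.equivFunOnFinite.symm
    (Sum.elim (fun i => (b.repr m i).toNat) fun i => (-b.repr m i).toNat)
  let w : DualLattice N → ℕ := fun m => ∑ i, (b.repr m i).natAbs
  have hsw : ∀ m m', s m' ≤ s m → w (m - m') + w m' = w m := by
    intro m m' h
    simp only [w, ← Finset.sum_add_distrib]
    refine Finset.sum_congr rfl fun i _ => ?_
    have h1 : (b.repr m' i).toNat ≤ (b.repr m i).toNat := h (Sum.inl i)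
    have h2 : (-b.repr m' i).toNat ≤ (-b.repr m i).toNat := h (Sum.inr i)
    rw [map_sub, Finsupp.sub_apply]
    omega
  have hw : ∀ m, m ≠ 0 → 0 < w m := by
    intro m hm
    rw [Nat.pos_iff_ne_zero]
    intro hw0
    refine hm (b.ext_elem fun i => ?_)
    have := (Finset.sum_eq_zero_iff.1 hw0) i (Finset.mem_univ i)
    simpa using this
  let I := {p : DualLattice N × K // p.1 ≠ 0 ∧ p.2 ≠ 0 ∧ single p.1 p.2 ∈ A}
  -- Tagging `f χ^m` with the monomial of exponent `s m` makes divisibility of monomials control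
  -- weights: a finite subfamily spans the ideal, and in the coefficient at `s m` only generators
  -- with `s m' ≤ s m` contribute, leaving cofactors of smaller norm.
  let e : I → MvPolynomial (ι ⊕ ι) A := fun p =>
    MvPolynomial.monomial (s p.1.1) ⟨single p.1.1 p.1.2, p.2.2.2⟩
  have hfg : (Ideal.span (Set.range e)).FG := IsNoetherian.noetherian _
  obtain ⟨T, hT, hspan⟩ := (Submodule.fg_span_iff_fg_span_finset_subset _).1 hfg
  obtain ⟨S, rfl⟩ : ∃ S : Finset I, S.image e = T := by
    rw [← Set.image_univ] at hT
    obtain ⟨S, -, hS⟩ := Finset.subset_set_image_iff.1 hT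
    exact ⟨S, hS⟩
  let gen : Fin S.card → I := fun i => (S.equivFin.symm i : I)
  let B : Subalgebra A₀ (AddMonoidAlgebra K (DualLattice N)) :=
    Algebra.adjoin A₀ (Set.range fun i => single (gen i).1.1 (gen i).1.2)
  have hgen : ∀ p ∈ S, single p.1.1 p.1.2 ∈ B := fun p hp =>
    Algebra.subset_adjoin ⟨S.equivFin ⟨p, hp⟩, by simp [gen]⟩
  have key : ∀ (n : ℕ) (m : DualLattice N) (f : K), w m = n → single m f ∈ A →
      single m f ∈ B := by
    intro n
    induction n using Nat.strong_induction_on with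
    | _ n ih =>
      intro m f hn hf
      by_cases hm : m = 0
      · subst hm
        have : f ∈ gradedPiece A 0 := hf
        rw [h0, Submodule.mem_one] at this
        obtain ⟨c, rfl⟩ := this
        exact B.algebraMap_mem c
      by_cases hf0 : f = 0
      · rw [hf0, single_zero]
        exact B.zero_mem
      have hmem : e ⟨(m, f), hm, hf0, hf⟩ ∈ Submodule.span (MvPolynomial (ι ⊕ ι) A)
          (e '' (S : Set I)) := by
        rw [← Finset.coe_image, ← hspan]
        exact Submodule.subset_span ⟨_, rfl⟩
      obtain ⟨c, hc⟩ := (Submodule.mem_span_image_finset_iff_exists_fun _).1 hmem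
      have hcoeff := congrArg (fun P => ((MvPolynomial.coeff (s m) P : A) :
        AddMonoidAlgebra K (DualLattice N)).coeff m) hc
      simp only [e, MvPolynomial.coeff_sum, smul_eq_mul, MvPolynomial.coeff_mul_monomial',
        MvPolynomial.coeff_monomial, if_true, coeff_single, Finsupp.single_eq_same] at hcoeff
      rw [AddSubmonoidClass.coe_finsetSum, coeff_sum, Finsupp.finsetSum_apply] at hcoeff
      rw [← hcoeff, ← singleAddHom_apply, map_sum]
      refine B.sum_mem fun p _ => ?_
      split_ifs with hle
      · obtain ⟨p, hp⟩ := p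
        set q := MvPolynomial.coeff (s m - s p.1.1) (c ⟨p, hp⟩)
        rw [singleAddHom_apply, Subalgebra.coe_mul, coeff_mul_single_eq_coeff_mul (m - p.1.1)
          fun j _ => eq_sub_iff_add_eq.symm]
        have h3 := hsw m p.1.1 hle
        have h4 := hw p.1.1 p.2.1
        have h5 := ih (w (m - p.1.1)) (by omega) (m - p.1.1) _ rfl (hA _ q.2 (m - p.1.1))
        have h6 := B.mul_mem h5 (hgen p hp)
        rwa [single_mul_single, sub_add_cancel] at h6
      · simp
  refine ⟨S.card, fun i => (gen i).1.2, fun i => (gen i).1.1, fun i => (gen i).2.2.1,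
    fun i => (gen i).2.1, le_antisymm (fun a ha => ?_) (Algebra.adjoin_le ?_)⟩
  · exact mem_of_forall_single_mem fun m => key _ m _ rfl (hA a ha m)
  · rintro _ ⟨i, rfl⟩
    exact (gen i).2.2.2

end FiniteGeneration

/-! ### Lattice points of the dual cone. -/

section DualCone

variable {N : Type*} [AddCommGroup N] {σ : PointedCone ℚ (RatSpace N)}

theorem mem_dualCone_hull {T : Set (RatSpace N)} {u : DualRatSpace N} :
    u ∈ dualCone (PointedCone.hull ℚ T) ↔ ∀ s ∈ T, 0 ≤ u s := by
  rw [dualCone, PointedCone.dual_hull]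
  rfl

variable [Module.Finite ℤ N]

/-- The dual of a cone which contains no line is full-dimensional. -/
theorem span_dualCone_eq_top (hσ : IsPointedPolyhedralCone σ) :
    Submodule.span ℚ (dualCone σ : Set (DualRatSpace N)) = ⊤ := by
  have h : (Submodule.span ℚ (dualCone σ : Set (DualRatSpace N))).dualCoannihilator = ⊥ := by
    rw [Submodule.eq_bot_iff]
    intro v hv
    rw [Submodule.mem_dualCoannihilator] at hv
    have hmem : ∀ w : RatSpace N, (∀ u ∈ dualCone σ, 0 ≤ u w) → w ∈ σ := by
      intro w hw
      rw [← PointedCone.FG.dual_id_dual_eval hσ.1]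
      exact fun u hu => hw u hu
    -- A vector killed by `σ^∨` satisfies, with its opposite, all the inequalities of `σ`, which
    -- would then contain a line.
    by_contra hv0
    refine hσ.2 v (hmem v fun u hu => (hv u (Submodule.subset_span hu)).ge) hv0
      (hmem (-v) fun u hu => ?_)
    rw [map_neg, hv u (Submodule.subset_span hu), neg_zero]
  rw [← Subspace.dualCoannihilator_dualAnnihilator_eq
    (W := Submodule.span ℚ (dualCone σ : Set (DualRatSpace N))), h,
    Submodule.dualAnnihilator_bot]

theorem exists_sub_of_mem_span {V : Type*} [AddCommGroup V] [Module ℚ V] (C : PointedCone ℚ V)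
    {u : V} (hu : u ∈ Submodule.span ℚ (C : Set V)) : ∃ a ∈ C, ∃ b ∈ C, u = a - b := by
  induction hu using Submodule.span_induction with
  | mem x hx => exact ⟨x, hx, 0, C.zero_mem, (sub_zero x).symm⟩
  | zero => exact ⟨0, C.zero_mem, 0, C.zero_mem, (sub_zero 0).symm⟩
  | add x y _ _ hx hy =>
    obtain ⟨a, ha, b, hb, rfl⟩ := hx
    obtain ⟨c, hc, d, hd, rfl⟩ := hy
    exact ⟨a + c, C.add_mem ha hc, b + d, C.add_mem hb hd, by abel⟩
  | smul c x _ hx =>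
    obtain ⟨a, ha, b, hb, rfl⟩ := hx
    rcases le_total 0 c with hc | hc
    · exact ⟨c • a, C.smul_mem hc ha, c • b, C.smul_mem hc hb, smul_sub _ _ _⟩
    · refine ⟨(-c) • b, C.smul_mem (neg_nonneg.2 hc) hb, (-c) • a,
        C.smul_mem (neg_nonneg.2 hc) ha, ?_⟩
      module

/-- Write `m = a - b` with `a, b` in the full-dimensional dual cone and scale `b` to a lattice point
`k • b`; then `m + k • b = a + (k - 1) • b`. Hence lattice points of the dual cone generate `M`. -/
theorem exists_add_mem_dualCone [Module.Free ℤ N] (hσ : IsPointedPolyhedralCone σ) (m : DualLattice N) :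
    ∃ m' : DualLattice N, toDualRat m' ∈ dualCone σ ∧ toDualRat (m + m') ∈ dualCone σ := by
  obtain ⟨a, ha, b, hb, hab⟩ := exists_sub_of_mem_span (dualCone σ) (u := toDualRat m)
    (by rw [span_dualCone_eq_top hσ]; exact Submodule.mem_top)
  obtain ⟨k, hk, m', hm'⟩ := exists_pos_smul_eq_toDualRat b
  refine ⟨m', hm' ▸ (dualCone σ).smul_mem (Nat.cast_nonneg k) hb, ?_⟩
  have : toDualRat (m + m') = a + ((k : ℚ) - 1) • b := by
    rw [map_add, hab, ← hm']
    module
  rw [this]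
  refine (dualCone σ).add_mem ha ((dualCone σ).smul_mem ?_ hb)
  have : (1 : ℚ) ≤ k := by exact_mod_cast hk
  linarith

end DualCone

theorem nonneg_of_forall_nat_add_mul_nonneg {a b : ℚ} (h : ∀ n : ℕ, 0 ≤ a + n * b) : 0 ≤ b := by
  by_contra! hb
  obtain ⟨n, hn⟩ := exists_nat_gt (a / -b)
  rw [div_lt_iff₀ (by linarith)] at hn
  linarith [h n]

/-! ### The algebra of a polyhedral divisor: normality, uniqueness, finite generation. -/

namespace PolyhedralDivisor

open AddMonoidAlgebra IsDedekindDomain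

variable {A₀ : Type*} [CommRing A₀] {N : Type*} [AddCommGroup N]
  {σ : PointedCone ℚ (RatSpace N)}

theorem supportValue_smul (D : PolyhedralDivisor A₀ σ) (z : HeightOneSpectrum A₀)
    {u : DualRatSpace N} (hu : u ∈ dualCone σ) {n : ℕ} (hnu : (n • u) ∈ dualCone σ) :
    D.supportValue z hnu = n * D.supportValue z hu := by
  have h := D.isLeast_supportValue z hu
  refine (D.isLeast_supportValue z hnu).unique ⟨?_, ?_⟩
  · obtain ⟨v, hv, hvu⟩ := h.1
    exact ⟨v, hv, by rw [← hvu, LinearMap.smul_apply, nsmul_eq_mul]⟩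
  · rintro _ ⟨v, hv, rfl⟩
    rw [LinearMap.smul_apply, nsmul_eq_mul]
    exact mul_le_mul_of_nonneg_left (h.2 ⟨v, hv, rfl⟩) (Nat.cast_nonneg n)

theorem le_supportValue_iff (D : PolyhedralDivisor A₀ σ) (z : HeightOneSpectrum A₀)
    {Q : Set (RatSpace N)} (hQ : D.coeff z = convexHull ℚ Q + (σ : Set (RatSpace N)))
    {u : DualRatSpace N} (hu : u ∈ dualCone σ) (c : ℚ) :
    c ≤ D.supportValue z hu ↔ ∀ q ∈ Q, c ≤ u q := by
  have h := D.isLeast_supportValue z hu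
  constructor
  · intro hc q hq
    refine hc.trans (h.2 ⟨q, ?_, rfl⟩)
    rw [hQ]
    exact ⟨q, subset_convexHull ℚ Q hq, 0, σ.zero_mem, add_zero q⟩
  · intro hc
    obtain ⟨v, hv, hvu⟩ := h.1
    rw [hQ] at hv
    obtain ⟨x, hx, s, hs, rfl⟩ := hv
    have hx' : x ∈ {y : RatSpace N | c ≤ u y} :=
      convexHull_min hc (convex_halfSpace_ge u.isLinear c) hx
    have hx'' : c ≤ u x := hx'
    have hs' : 0 ≤ u s := mem_dualCone.1 hu s hs
    rw [← hvu]
    simp only [map_add]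
    linarith

/-- Since `n` is an integer the floor can be dropped, and a bound on the minimum is a bound at every
point. Membership thus becomes a family of linear inequalities. -/
theorem nonneg_add_floor_iff {D : PolyhedralDivisor A₀ σ} (z : HeightOneSpectrum A₀)
    {u : DualRatSpace N} (hu : u ∈ dualCone σ) (n : ℤ) :
    0 ≤ n + ⌊D.supportValue z hu⌋ ↔ ∀ v ∈ D.coeff z, 0 ≤ n + u v := by
  have h := D.isLeast_supportValue z hu
  have h1 : 0 ≤ n + ⌊D.supportValue z hu⌋ ↔ ((-n : ℤ) : ℚ) ≤ D.supportValue z hu := by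
    rw [← Int.le_floor]
    constructor <;> intro h <;> linarith
  rw [h1]
  constructor
  · intro hn v hv
    have := h.2 ⟨v, hv, rfl⟩
    push_cast at hn
    linarith
  · intro hn
    obtain ⟨v, hv, hvu⟩ := h.1
    rw [← hvu]
    push_cast
    linarith [hn v hv]

variable [IsDedekindDomain A₀] {K : Type*} [Field K] [Algebra A₀ K] [IsFractionRing A₀ K]

theorem single_mem_sectionAlgebra {D : PolyhedralDivisor A₀ σ} {m : DualLattice N} {f : K} :
    single m f ∈ D.sectionAlgebra K ↔ f ∈ D.piece K (toDualRat m) := by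
  classical
  rw [mem_sectionAlgebra]
  constructor
  · intro h
    simpa using h m
  · intro h k
    rw [coeff_single, Finsupp.single_apply]
    split_ifs with hk
    · rwa [← hk]
    · exact Submodule.zero_mem _

theorem single_mem_sectionAlgebra_iff {D : PolyhedralDivisor A₀ σ} {m : DualLattice N} {f : K}
    (hf : f ≠ 0) : single m f ∈ D.sectionAlgebra K ↔
      ∃ hm : toDualRat m ∈ dualCone σ, ∀ z, 0 ≤ ordAt z f + ⌊D.supportValue z hm⌋ := by
  rw [single_mem_sectionAlgebra]
  by_cases hm : toDualRat m ∈ dualCone σ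
  · rw [mem_piece K hm]
    exact ⟨fun h => ⟨hm, h hf⟩, fun ⟨_, h⟩ _ => h⟩
  · rw [mem_piece_of_not_mem K hm]
    exact ⟨fun h => absurd h hf, fun ⟨h, _⟩ => absurd h hm⟩

theorem isGradedSubalgebra_sectionAlgebra (D : PolyhedralDivisor A₀ σ) :
    IsGradedSubalgebra (D.sectionAlgebra K) :=
  fun _ ha m => single_mem_sectionAlgebra.2 (ha m)

/-- Both conditions on a weight and a coefficient are linear inequalities, and `a + n * b ≥ 0` for
all `n` forces `b ≥ 0`. -/
theorem single_mem_sectionAlgebra_of_forall_pow (D : PolyhedralDivisor A₀ σ)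
    (l m : DualLattice N) (g f : K) (hg : g ≠ 0)
    (h : ∀ n : ℕ, single (l + n • m) (g * f ^ n) ∈ D.sectionAlgebra K) :
    single m f ∈ D.sectionAlgebra K := by
  by_cases hf : f = 0
  · rw [hf, single_zero]
    exact Subalgebra.zero_mem _
  have h' := fun n => (single_mem_sectionAlgebra_iff (mul_ne_zero hg (pow_ne_zero n hf))).1 (h n)
  have heval : ∀ (n : ℕ) (v : RatSpace N),
      toDualRat (l + n • m) v = toDualRat l v + n * toDualRat m v := fun n v => by
    rw [map_add, map_nsmul, LinearMap.add_apply, LinearMap.smul_apply, nsmul_eq_mul]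
  have hm : toDualRat m ∈ dualCone σ := by
    refine mem_dualCone.2 fun s hs => nonneg_of_forall_nat_add_mul_nonneg (a := toDualRat l s) ?_
    intro n
    obtain ⟨hn, -⟩ := h' n
    rw [← heval]
    exact mem_dualCone.1 hn s hs
  refine (single_mem_sectionAlgebra_iff hf).2 ⟨hm, fun z => ?_⟩
  rw [nonneg_add_floor_iff]
  intro v hv
  refine nonneg_of_forall_nat_add_mul_nonneg (a := ordAt z g + toDualRat l v) fun n => ?_
  obtain ⟨hn, hz⟩ := h' n
  have := (nonneg_add_floor_iff z hn _).1 (hz z) v hv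
  rw [heval, ordAt_mul z hg (pow_ne_zero n hf), ordAt_pow] at this
  push_cast at this
  linarith

theorem gradedPiece_sectionAlgebra_ne_bot (D : PolyhedralDivisor A₀ σ) {m : DualLattice N}
    (hm : toDualRat m ∈ dualCone σ) : gradedPiece (D.sectionAlgebra K) m ≠ ⊥ := by
  obtain ⟨f, hf, hf0⟩ := exists_mem_globalSections_ne_zero (K := K) (D.floorEval hm)
  refine gradedPiece_ne_bot hf0 (single_mem_sectionAlgebra.2 ?_)
  rwa [piece, dif_pos hm]

variable [Module.Free ℤ N] [Module.Finite ℤ N]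

theorem hasFullFractionField_sectionAlgebra (hσ : IsPointedPolyhedralCone σ)
    (D : PolyhedralDivisor A₀ σ) : HasFullFractionField (D.sectionAlgebra K) := by
  refine hasFullFractionField_of_closure_eq_top _ ((AddSubgroup.eq_top_iff' _).2 fun m => ?_)
  obtain ⟨m', h1, h2⟩ := exists_add_mem_dualCone hσ m
  rw [← add_sub_cancel_right m m']
  exact AddSubgroup.sub_mem _
    (AddSubgroup.subset_closure (D.gradedPiece_sectionAlgebra_ne_bot h2))
    (AddSubgroup.subset_closure (D.gradedPiece_sectionAlgebra_ne_bot h1))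

theorem isIntegrallyClosed_sectionAlgebra (hσ : IsPointedPolyhedralCone σ)
    (D : PolyhedralDivisor A₀ σ) : IsIntegrallyClosed (D.sectionAlgebra K) :=
  isIntegrallyClosed_of_homogeneous D.isGradedSubalgebra_sectionAlgebra
    (D.hasFullFractionField_sectionAlgebra hσ) D.single_mem_sectionAlgebra_of_forall_pow

/-- A polyhedral divisor is determined by its algebra of sections. -/
theorem coeff_subset_of_sectionAlgebra_le (hσ : σ.FG) {D D' : PolyhedralDivisor A₀ σ}
    (h : D'.sectionAlgebra K ≤ D.sectionAlgebra K) (z : HeightOneSpectrum A₀) :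
    D.coeff z ⊆ D'.coeff z := by
  intro v hv
  by_contra hv'
  obtain ⟨Q, hQ, hne, hQσ⟩ := D'.isSigmaPolyhedron z
  rw [hQσ] at hv'
  obtain ⟨u, huσ, huv⟩ := exists_separating_form hQ hne hσ hv'
  obtain ⟨k, hk, m, hm⟩ := exists_pos_smul_eq_toDualRat u
  have hkQ : (0 : ℚ) < k := by exact_mod_cast hk
  have hmσ : toDualRat m ∈ dualCone σ := by
    rw [← hm]
    exact (dualCone σ).smul_mem hkQ.le (mem_dualCone.2 huσ)
  obtain ⟨q, hq, hqmin⟩ := Set.exists_min_image Q (toDualRat m) hQ hne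
  have hlt : D.supportValue z hmσ < D'.supportValue z hmσ := by
    have h1 : toDualRat m q ≤ D'.supportValue z hmσ :=
      (D'.le_supportValue_iff z hQσ hmσ _).2 hqmin
    have h2 : D.supportValue z hmσ ≤ toDualRat m v :=
      (D.isLeast_supportValue z hmσ).2 ⟨v, hv, rfl⟩
    have h3 : toDualRat m v < toDualRat m q := by
      rw [← hm, LinearMap.smul_apply, LinearMap.smul_apply]
      exact mul_lt_mul_of_pos_left (huv q hq) hkQ
    linarith
  -- Multiplying `m` by the denominator of `c` makes the larger support value integral, so the
  -- strict inequality survives taking floors.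
  obtain ⟨c, hc⟩ : ∃ c, c = D'.supportValue z hmσ := ⟨_, rfl⟩
  have hmn : toDualRat (c.den • m) ∈ dualCone σ := by
    rw [map_nsmul]
    exact (dualCone σ).nsmul_mem hmσ _
  have hle : globalSections K (D'.floorEval hmn) ≤ globalSections K (D.floorEval hmn) := by
    intro f hf
    have h1 : single (c.den • m) f ∈ D'.sectionAlgebra K := by
      rw [single_mem_sectionAlgebra, piece, dif_pos hmn]
      exact hf
    have h2 := h h1
    rwa [single_mem_sectionAlgebra, piece, dif_pos hmn] at h2
  have hfl := le_of_globalSections_le hle z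
  have hmn' : c.den • toDualRat m ∈ dualCone σ := by rwa [← map_nsmul]
  have e1 : D'.supportValue z hmn = c.den * D'.supportValue z hmσ := by
    rw [← D'.supportValue_smul z hmσ hmn']
    congr 1
    exact map_nsmul _ _ _
  have e2 : D.supportValue z hmn = c.den * D.supportValue z hmσ := by
    rw [← D.supportValue_smul z hmσ hmn']
    congr 1
    exact map_nsmul _ _ _
  rw [floorEval_apply, floorEval_apply, e1, e2, ← hc, Rat.den_mul_eq_num, Int.floor_intCast,
    Int.le_floor, ← Rat.den_mul_eq_num] at hfl
  have hden : (0 : ℚ) < c.den := by exact_mod_cast c.den_pos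
  exact absurd (le_of_mul_le_mul_left hfl hden) (hc ▸ hlt).not_ge

theorem eq_of_sectionAlgebra_eq (hσ : σ.FG) {D D' : PolyhedralDivisor A₀ σ}
    (h : D.sectionAlgebra K = D'.sectionAlgebra K) : D = D' :=
  PolyhedralDivisor.ext (funext fun z =>
    Set.Subset.antisymm (coeff_subset_of_sectionAlgebra_le hσ h.ge z)
      (coeff_subset_of_sectionAlgebra_le hσ h.le z))

/-- The algebra of sections of a polyhedral divisor is finitely generated. -/
theorem fg_sectionAlgebra (hσ : σ.FG) (D : PolyhedralDivisor A₀ σ) :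
    (D.sectionAlgebra K).FG := by
  classical
  obtain ⟨T, hT⟩ := hσ
  have hdual : ∀ u, u ∈ dualCone σ ↔ ∀ s ∈ T, 0 ≤ u s := fun u => by
    rw [← hT]
    exact mem_dualCone_hull
  choose Q hQ hQne hQσ using D.isSigmaPolyhedron
  let Z := {z : HeightOneSpectrum A₀ // D.coeff z ≠ (σ : Set (RatSpace N))}
  have : Finite Z := D.finite_support
  have (z : HeightOneSpectrum A₀) : Finite (Q z) := hQ z
  let G := DualLattice N × (Z → ℤ)
  have : AddGroup.FG (DualLattice N) := Module.Finite.iff_addGroup_fg.1 inferInstance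
  -- Pairs of a weight `m ∈ σ^∨` and an integral divisor bounded by `𝔇(m)`, supported where `𝔇` is
  -- nontrivial. Unlike the floor of `𝔇(m)`, such pairs are closed under addition.
  let S : AddSubmonoid G :=
    { carrier := {x | (∀ s ∈ T, 0 ≤ toDualRat x.1 s) ∧
        ∀ z : Z, ∀ q ∈ Q z, (x.2 z : ℚ) ≤ toDualRat x.1 q}
      zero_mem' := by simp
      add_mem' := by
        rintro x y ⟨hx1, hx2⟩ ⟨hy1, hy2⟩
        refine ⟨fun s hs => ?_, fun z q hq => ?_⟩
        · rw [Prod.fst_add, map_add, LinearMap.add_apply]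
          exact add_nonneg (hx1 s hs) (hy1 s hs)
        · rw [Prod.fst_add, map_add, LinearMap.add_apply, Prod.snd_add, Pi.add_apply]
          push_cast
          exact add_le_add (hx2 z q hq) (hy2 z q hq) }
  have hSfg : S.FG := by
    choose k hk l hl using exists_intForm (N := N)
    refine AddSubmonoid.fg_of_forall_nonneg (ι := T ⊕ (Σ z : Z, Q z))
      (Sum.elim (fun s => (l s).comp (AddMonoidHom.fst _ _)) fun p =>
        (l p.2).comp (AddMonoidHom.fst _ _) -
          (k p.2) • (Pi.evalAddMonoidHom _ p.1).comp (AddMonoidHom.snd _ _)) S fun x => ?_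
    rw [Sum.forall]
    refine and_congr ?_ ?_
    · rw [Subtype.forall]
      refine forall₂_congr fun s _ => ?_
      have h1 := hl s x.1
      have h2 : (0 : ℚ) < k s := by exact_mod_cast hk s
      change _ ↔ 0 ≤ l s x.1
      rw [← Int.cast_nonneg_iff (R := ℚ), h1, mul_nonneg_iff_of_pos_left h2]
    · rw [Sigma.forall]
      refine forall_congr' fun z => ?_
      rw [Subtype.forall]
      refine forall₂_congr fun q _ => ?_
      have h1 := hl q x.1
      have h2 : (0 : ℚ) < k q := by exact_mod_cast hk q
      change _ ↔ 0 ≤ l q x.1 - k q • x.2 z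
      rw [← Int.cast_nonneg_iff (R := ℚ), Int.cast_sub, h1, nsmul_eq_mul]
      push_cast
      rw [← mul_sub, mul_nonneg_iff_of_pos_left h2, sub_nonneg]
  let E : (Z → ℤ) → (HeightOneSpectrum A₀ →₀ ℤ) := fun e =>
    (Finsupp.equivFunOnFinite.symm e).mapDomain Subtype.val
  have hE1 : ∀ e (z : Z), E e z = e z := fun e z =>
    Finsupp.mapDomain_apply Subtype.val_injective _ _
  have hE2 : ∀ e z, D.coeff z = σ → E e z = 0 := fun e z hz =>
    Finsupp.mapDomain_of_notMem_range _ _ (by rintro ⟨w, rfl⟩; exact w.2 hz)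
  have hEadd : ∀ e e', E (e + e') = E e + E e' := fun e e' => by
    ext z
    by_cases hz : D.coeff z = σ
    · rw [Finsupp.add_apply, hE2 _ z hz, hE2 _ z hz, hE2 _ z hz, add_zero]
    · have := hE1 (e + e') ⟨z, hz⟩
      rw [Finsupp.add_apply, this, hE1 e ⟨z, hz⟩, hE1 e' ⟨z, hz⟩, Pi.add_apply]
  obtain ⟨F, hF⟩ := hSfg
  choose H hH using fun D : HeightOneSpectrum A₀ →₀ ℤ => globalSections_fg (K := K) D
  let gens : Finset (AddMonoidAlgebra K (DualLattice N)) :=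
    F.biUnion fun x => (H (E x.2)).image (single x.1)
  let B := Algebra.adjoin A₀ (gens : Set (AddMonoidAlgebra K (DualLattice N)))
  have key : ∀ x ∈ AddSubmonoid.closure (F : Set G),
      globalSections K (E x.2) ≤ gradedPiece B x.1 := by
    intro x hx
    induction hx using AddSubmonoid.closure_induction with
    | mem x hx =>
      rw [← hH (E x.2), Submodule.span_le]
      intro f hf
      exact Algebra.subset_adjoin (Finset.mem_coe.2
        (Finset.mem_biUnion.2 ⟨x, hx, Finset.mem_image.2 ⟨f, hf, rfl⟩⟩))
    | zero =>
      intro f hf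
      obtain ⟨c, rfl⟩ := mem_range_algebraMap_of_ordAt_nonneg (A₀ := A₀) (f := f) fun hf0 z => by
        have h1 := hf hf0 z
        have h2 : E (0 : G).2 z = 0 := by
          by_cases hz : D.coeff z = σ
          · exact hE2 _ z hz
          · exact hE1 0 ⟨z, hz⟩
        rwa [h2, add_zero] at h1
      exact B.algebraMap_mem c
    | add x y _ _ hx hy =>
      rw [Prod.snd_add, hEadd, Prod.fst_add]
      refine (globalSections_add_le _ _).trans (Submodule.mul_le.2 fun f hf g hg => ?_)
      rw [mem_gradedPiece, ← single_mul_single]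
      exact B.mul_mem (hx hf) (hy hg)
  rw [hF] at key
  refine ⟨gens, le_antisymm (Algebra.adjoin_le fun a ha => ?_) fun a ha => ?_⟩
  · obtain ⟨x, hx, hxa⟩ := Finset.mem_biUnion.1 (Finset.mem_coe.1 ha)
    obtain ⟨f, hf, rfl⟩ := Finset.mem_image.1 hxa
    have hxS : x ∈ S := hF ▸ AddSubmonoid.subset_closure hx
    have hfE : f ∈ globalSections K (E x.2) := hH (E x.2) ▸ Submodule.subset_span hf
    have hxσ : toDualRat x.1 ∈ dualCone σ := (hdual _).2 hxS.1
    refine single_mem_sectionAlgebra.2 ((mem_piece K hxσ).2 fun hf0 z => ?_)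
    refine (hfE hf0 z).trans (add_le_add le_rfl ?_)
    by_cases hz : D.coeff z = σ
    · rw [hE2 _ z hz, D.supportValue_eq_zero hz, Int.floor_zero]
    · rw [hE1 _ ⟨z, hz⟩, Int.le_floor, D.le_supportValue_iff z (hQσ z)]
      exact hxS.2 ⟨z, hz⟩
  · refine mem_of_forall_single_mem fun m => ?_
    by_cases hm : toDualRat m ∈ dualCone σ
    · have ham := ha m
      rw [piece, dif_pos hm] at ham
      -- The whole piece of weight `m` comes from the largest admissible divisor.
      let x : G := (m, fun z => D.floorEval hm z)
      have hx : x ∈ S := ⟨(hdual _).1 hm, fun z => by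
        refine (D.le_supportValue_iff z (hQσ z) hm _).1 ?_
        exact Int.floor_le _⟩
      have hEx : E x.2 = D.floorEval hm := by
        ext z
        by_cases hz : D.coeff z = σ
        · rw [hE2 _ z hz, floorEval_apply, D.supportValue_eq_zero hz, Int.floor_zero]
        · exact hE1 _ ⟨z, hz⟩
      exact key x hx (hEx ▸ ham)
    · rw [(mem_piece_of_not_mem K hm).1 (ha m), single_zero]
      exact B.zero_mem

theorem isNoetherianRing_sectionAlgebra (hσ : σ.FG) (D : PolyhedralDivisor A₀ σ) :
    IsNoetherianRing (D.sectionAlgebra K) :=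
  isNoetherianRing_of_fg (D.fg_sectionAlgebra hσ)

end PolyhedralDivisor

theorem exists_common_denominator {ι : Type*} [Fintype ι] (c : ι → ℚ) (hc : ∀ i, 0 ≤ c i) :
    ∃ n : ℕ, 0 < n ∧ ∃ a : ι → ℕ, ∀ i, (a i : ℚ) = n * c i := by
  classical
  refine ⟨∏ i, (c i).den, Finset.prod_pos fun i _ => (c i).den_pos, ?_⟩
  have h : ∀ i, ∃ a : ℕ, (a : ℚ) = (∏ i, (c i).den : ℕ) * c i := by
    intro i
    obtain ⟨d, hd⟩ := Finset.dvd_prod_of_mem (fun i => (c i).den) (Finset.mem_univ i)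
    have hd' : ∏ i, (c i).den = (c i).den * d := hd
    have hnum : ((c i).num.toNat : ℚ) = (c i).num := by
      exact_mod_cast Int.toNat_of_nonneg (Rat.num_nonneg.2 (hc i))
    refine ⟨(c i).num.toNat * d, ?_⟩
    rw [hd']
    push_cast
    rw [mul_right_comm, Rat.den_mul_eq_num, hnum]
  choose a ha using h
  exact ⟨a, ha⟩

/-! ### The divisor `𝔇[f]` and normalization. -/

section Generators

open AddMonoidAlgebra IsDedekindDomain

variable {N : Type*} [AddCommGroup N] {r : ℕ} {m : Fin r → DualLattice N}

theorem mem_dualOfWeights {v : RatSpace N} :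
    v ∈ dualOfWeights m ↔ ∀ i, 0 ≤ toDualRat (m i) v := by
  rw [dualOfWeights, PointedCone.dual_hull, PointedCone.mem_dual, Set.forall_mem_range]
  rfl

theorem toDualRat_sum_nsmul (a : Fin r → ℕ) :
    toDualRat (∑ i, a i • m i) = ∑ i, (a i : ℚ) • toDualRat (m i) := by
  rw [map_sum]
  exact Finset.sum_congr rfl fun i _ => by rw [map_nsmul, Nat.cast_smul_eq_nsmul]

section Adjoin

variable {A₀ : Type*} [CommRing A₀] {K : Type*} [Field K] [Algebra A₀ K] {f : Fin r → K}

theorem single_sum_prod_mem_adjoin (a : Fin r → ℕ) :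
    single (∑ i, a i • m i) (∏ i, f i ^ a i) ∈
      Algebra.adjoin A₀ (Set.range fun i => single (m i) (f i)) := by
  classical
  have h : ∀ s : Finset (Fin r), single (∑ i ∈ s, a i • m i) (∏ i ∈ s, f i ^ a i) ∈
      Algebra.adjoin A₀ (Set.range fun i => single (m i) (f i)) := by
    intro s
    induction s using Finset.induction_on with
    | empty => exact Subalgebra.one_mem _
    | insert i s hi ih =>
      rw [Finset.sum_insert hi, Finset.prod_insert hi, ← single_mul_single, ← single_pow]
      exact Subalgebra.mul_mem _
        (Subalgebra.pow_mem _ (Algebra.subset_adjoin (Set.mem_range_self i)) _) ih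
  exact h Finset.univ

theorem mem_of_mem_adjoin_of_coeff_ne_zero (H : AddSubmonoid (DualLattice N))
    (hH : ∀ i, m i ∈ H) {a : AddMonoidAlgebra K (DualLattice N)}
    (ha : a ∈ Algebra.adjoin A₀ (Set.range fun i => single (m i) (f i))) (k : DualLattice N)
    (hk : a.coeff k ≠ 0) : k ∈ H := by
  classical
  induction ha using Algebra.adjoin_induction generalizing k with
  | mem x hx =>
    obtain ⟨i, rfl⟩ := hx
    rw [coeff_single, Finsupp.single_apply_ne_zero] at hk
    exact hk.1 ▸ hH i
  | algebraMap c =>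
    rw [algebraMap_eq_single, coeff_single, Finsupp.single_apply_ne_zero] at hk
    exact hk.1 ▸ H.zero_mem
  | add x y _ _ hx hy =>
    rw [coeff_add, Finsupp.add_apply] at hk
    by_cases h : x.coeff k = 0
    · rw [h, zero_add] at hk
      exact hy k hk
    · exact hx k h
  | mul x y _ _ hx hy =>
    obtain ⟨p, hp, q, hq, rfl⟩ :=
      Finset.mem_add.1 (support_coeff_mul_subset x y (Finsupp.mem_support_iff.2 hk))
    exact H.add_mem (hx p (Finsupp.mem_support_iff.1 hp)) (hy q (Finsupp.mem_support_iff.1 hq))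

theorem weightCone_adjoin (hf : ∀ i, f i ≠ 0) :
    weightCone (Algebra.adjoin A₀ (Set.range fun i => single (m i) (f i))) =
      PointedCone.hull ℚ (Set.range fun i => toDualRat (m i)) := by
  refine le_antisymm (Submodule.span_le.2 ?_) (Submodule.span_mono ?_)
  · rintro _ ⟨k, hk, rfl⟩
    obtain ⟨g, hg0, hg⟩ := exists_ne_zero_of_gradedPiece_ne_bot hk
    let H : AddSubmonoid (DualLattice N) :=
      (PointedCone.hull ℚ (Set.range fun i => toDualRat (m i))).toAddSubmonoid.comap
        (toDualRat (N := N)).toAddMonoidHom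
    exact mem_of_mem_adjoin_of_coeff_ne_zero H
      (fun i => PointedCone.subset_hull ⟨i, rfl⟩) hg k (by simpa using hg0)
  · rintro _ ⟨i, rfl⟩
    exact ⟨m i, gradedPiece_ne_bot (hf i) (Algebra.subset_adjoin ⟨i, rfl⟩), rfl⟩

/-- All weights lie in the sublattice spanned by the `m i`, and a full fraction field leaves no room
for a proper one. -/
theorem span_eq_top_of_hasFullFractionField
    (h : HasFullFractionField (Algebra.adjoin A₀ (Set.range fun i => single (m i) (f i)))) :
    Submodule.span ℤ (Set.range m) = ⊤ := by
  refine (Submodule.eq_top_iff').2 fun k =>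
    mem_of_hasFullFractionField h (Submodule.span ℤ (Set.range m)).toAddSubgroup
      (fun a ha k hk => ?_) k
  exact mem_of_mem_adjoin_of_coeff_ne_zero (Submodule.span ℤ (Set.range m)).toAddSubmonoid
    (fun i => Submodule.subset_span ⟨i, rfl⟩) ha k hk

end Adjoin

variable {A₀ : Type*} [CommRing A₀] [IsDedekindDomain A₀]
  {K : Type*} [Field K] [Algebra A₀ K] [IsFractionRing A₀ K] {f : Fin r → K}

theorem adjoin_le_sectionAlgebra (hf : ∀ i, f i ≠ 0) {D : PolyhedralDivisor A₀ (dualOfWeights m)}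
    (hD : ∀ z, D.coeff z = generatorPolyhedron f m z) :
    Algebra.adjoin A₀ (Set.range fun i => single (m i) (f i)) ≤ D.sectionAlgebra K := by
  refine Algebra.adjoin_le ?_
  rintro _ ⟨i, rfl⟩
  refine (PolyhedralDivisor.single_mem_sectionAlgebra_iff (hf i)).2
    ⟨mem_dualCone.2 fun v hv => mem_dualOfWeights.1 hv i, fun z => ?_⟩
  rw [PolyhedralDivisor.nonneg_add_floor_iff]
  intro v hv
  rw [hD] at hv
  linarith [hv i]

variable [Module.Finite ℤ N]

theorem dualCone_dualOfWeights :
    dualCone (dualOfWeights m) = PointedCone.hull ℚ (Set.range fun i => toDualRat (m i)) :=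
  PointedCone.FG.dual_eval_dual_id (Submodule.fg_span (Set.finite_range _))

/-- The polyhedral divisor `𝔇[f]` attached to homogeneous generators. -/
theorem exists_polyhedralDivisor_coeff_eq (hf : ∀ i, f i ≠ 0)
    (hne : ∀ z : HeightOneSpectrum A₀, (generatorPolyhedron f m z).Nonempty) :
    ∃ D : PolyhedralDivisor A₀ (dualOfWeights m), ∀ z, D.coeff z = generatorPolyhedron f m z := by
  refine ⟨⟨fun z => generatorPolyhedron f m z, fun z => ?_, ?_⟩, fun z => rfl⟩
  · exact exists_convexHull_add_eq_polyhedron (fun i => toDualRat (m i))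
      (fun i => -(ordAt z (f i) : ℚ)) (hne z) (dualOfWeights m) fun v => mem_dualOfWeights
  · refine (Set.finite_iUnion fun i => finite_ordAt_ne_zero (A₀ := A₀) (hf i)).subset
      fun z hz => ?_
    by_contra hcon
    simp only [Set.mem_iUnion, Set.mem_ofPred_eq, not_exists, not_not] at hcon
    refine hz (Set.ext fun v => ?_)
    rw [SetLike.mem_coe, mem_dualOfWeights]
    exact forall_congr' fun i => by rw [hcon i, Int.cast_zero, neg_zero]

/-- If the algebra generated by the `f_i χ^{m_i}` has degree zero part `A₀`, then the polyhedra
`Δ_z[f]` are nonempty. -/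
theorem generatorPolyhedron_nonempty (hf : ∀ i, f i ≠ 0)
    (h0 : gradedPiece (Algebra.adjoin A₀ (Set.range fun i => single (m i) (f i))) 0 = 1)
    (z : HeightOneSpectrum A₀) : (generatorPolyhedron f m z).Nonempty := by
  by_contra hne
  -- Cleared of denominators, the certificate is a monomial in the generators of weight zero whose
  -- coefficient has negative order at `z`.
  obtain ⟨l, hl, hl0, hlpos⟩ := exists_certificate_of_infeasible (fun i => toDualRat (m i))
    (fun i => -(ordAt z (f i) : ℚ)) hne
  obtain ⟨n, hn, a, ha⟩ := exists_common_denominator l hl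
  have hmem : ∏ i, f i ^ a i ∈
      gradedPiece (Algebra.adjoin A₀ (Set.range fun i => single (m i) (f i))) 0 := by
    have : (0 : DualLattice N) = ∑ i, a i • m i := by
      apply toDualRat_injective
      rw [map_zero, toDualRat_sum_nsmul]
      simp_rw [ha, mul_smul]
      rw [← Finset.smul_sum, hl0, smul_zero]
    rw [this]
    exact single_sum_prod_mem_adjoin _
  rw [h0, Submodule.mem_one] at hmem
  obtain ⟨c, hc⟩ := hmem
  have hprod : ∏ i, f i ^ a i ≠ 0 := Finset.prod_ne_zero_iff.2 fun i _ => pow_ne_zero _ (hf i)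
  have hc0 : c ≠ 0 := by
    rintro rfl
    exact hprod (by rw [← hc, map_zero])
  have h1 := ordAt_algebraMap_nonneg (K := K) z hc0
  rw [hc, ordAt_prod_pow z _ _ _ fun i _ => hf i, ← Int.cast_nonneg_iff (R := ℚ)] at h1
  push_cast at h1
  have h2 : ∑ i, (a i : ℚ) * ordAt z (f i) = -(n * ∑ i, l i * -(ordAt z (f i) : ℚ)) := by
    rw [Finset.mul_sum, ← Finset.sum_neg_distrib]
    exact Finset.sum_congr rfl fun i _ => by rw [ha]; ring
  have h3 : (0 : ℚ) < n := by exact_mod_cast hn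
  have := mul_pos h3 hlpos
  linarith

/-- The homogeneous sections of `𝔇[f]` are integral over the algebra generated by the
`f_i χ^{m_i}`. -/
theorem isIntegral_single_of_mem_sectionAlgebra (hf : ∀ i, f i ≠ 0)
    {D : PolyhedralDivisor A₀ (dualOfWeights m)}
    (hD : ∀ z, D.coeff z = generatorPolyhedron f m z) {k : DualLattice N} {b : K}
    (hb : single k b ∈ D.sectionAlgebra K) :
    IsIntegral (Algebra.adjoin A₀ (Set.range fun i => single (m i) (f i))) (single k b) := by
  classical
  set A := Algebra.adjoin A₀ (Set.range fun i => single (m i) (f i)) with hA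
  by_cases hb0 : b = 0
  · rw [hb0, single_zero]
    exact isIntegral_zero
  obtain ⟨hk, hbz⟩ := (PolyhedralDivisor.single_mem_sectionAlgebra_iff hb0).1 hb
  let Z : Set (HeightOneSpectrum A₀) := ⋃ i, {z | ordAt z (f i) ≠ 0}
  have hZ : Z.Finite := Set.finite_iUnion fun i => finite_ordAt_ne_zero (hf i)
  have : Fintype Z := hZ.fintype
  -- One combination for each point of `Z`, adapted to the order of `b` there, and one (`none`) for
  -- all remaining points, where only the weight matters.
  have hcomb : ∀ o : Option Z, ∃ l : Fin r → ℚ, (∀ i, 0 ≤ l i) ∧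
      ∑ i, l i • toDualRat (m i) = toDualRat k ∧
      ∀ z ∈ o, ∑ i, l i * ordAt (z : HeightOneSpectrum A₀) (f i) ≤
        ordAt (z : HeightOneSpectrum A₀) b := by
    rintro (_ | z)
    · have hk' := hk
      rw [dualCone_dualOfWeights] at hk'
      obtain ⟨c, hc⟩ := (Submodule.mem_span_range_iff_exists_fun _).1 hk'
      exact ⟨fun i => c i, fun i => (c i).2, hc, by simp⟩
    · obtain ⟨v₀, hv₀⟩ : (generatorPolyhedron f m z.1).Nonempty := by
        obtain ⟨v, hv, -⟩ := (D.isLeast_supportValue z hk).1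
        exact ⟨v, hD z ▸ hv⟩
      obtain ⟨l, hl, hlk, hle⟩ := exists_combination_of_le_on_polyhedron
        (fun i => toDualRat (m i)) (fun i => -(ordAt z.1 (f i) : ℚ)) hv₀ (toDualRat k)
        (-(ordAt z.1 b : ℚ)) fun v hv => by
          have := (PolyhedralDivisor.nonneg_add_floor_iff z.1 hk _).1 (hbz z) v
            (by rw [hD]; exact hv)
          linarith
      refine ⟨l, hl, hlk, ?_⟩
      rintro _ ⟨⟩
      simp only [mul_neg, Finset.sum_neg_distrib] at hle
      linarith
  choose l hl hlk hlo using hcomb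
  obtain ⟨n, hn, a, ha⟩ := exists_common_denominator (fun p : Option Z × Fin r => l p.1 p.2)
    fun p => hl p.1 p.2
  let F : Option Z → K := fun o => ∏ i, f i ^ a (o, i)
  have hF0 : ∀ o, F o ≠ 0 := fun o => Finset.prod_ne_zero_iff.2 fun i _ => pow_ne_zero _ (hf i)
  have hFord : ∀ o (z : HeightOneSpectrum A₀), ordAt z (F o) = ∑ i, a (o, i) * ordAt z (f i) :=
    fun o z => ordAt_prod_pow z _ _ _ fun i _ => hf i
  have hFA : ∀ o, F o ∈ gradedPiece A (n • k) := by
    intro o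
    have : n • k = ∑ i, a (o, i) • m i := by
      apply toDualRat_injective
      rw [toDualRat_sum_nsmul, map_nsmul, ← hlk o, Finset.smul_sum]
      refine Finset.sum_congr rfl fun i _ => ?_
      rw [ha (o, i), mul_smul, Nat.cast_smul_eq_nsmul]
    rw [this]
    exact single_sum_prod_mem_adjoin _
  have hbn : b ^ n ∈ gradedPiece A (n • k) := by
    have hle : Submodule.span A₀ (Set.range F) ≤ gradedPiece A (n • k) :=
      Submodule.span_le.2 (by rintro _ ⟨o, rfl⟩; exact hFA o)
    refine hle (mem_span_of_forall_exists_ordAt_le ⟨F none, Set.mem_range_self none, hF0 none⟩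
      (pow_ne_zero n hb0) fun z => ?_)
    by_cases hz : z ∈ Z
    · refine ⟨F (some ⟨z, hz⟩), ⟨_, rfl⟩, hF0 _, ?_⟩
      have h1 := hlo (some ⟨z, hz⟩) ⟨z, hz⟩ rfl
      rw [hFord, ordAt_pow, ← Int.cast_le (R := ℚ)]
      push_cast
      have h2 : ∑ i, (a (some ⟨z, hz⟩, i) : ℚ) * ordAt z (f i) =
          n * ∑ i, l (some ⟨z, hz⟩) i * ordAt z (f i) := by
        rw [Finset.mul_sum]
        exact Finset.sum_congr rfl fun i _ => by rw [ha, mul_assoc]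
      rw [h2]
      exact mul_le_mul_of_nonneg_left h1 (Nat.cast_nonneg n)
    · refine ⟨F none, ⟨none, rfl⟩, hF0 _, ?_⟩
      simp only [Z, Set.mem_iUnion, Set.mem_ofPred_eq, not_exists, not_not] at hz
      -- Off `Z` the polyhedron contains `0`, so `b` has nonnegative order, while `F none` has order
      -- zero.
      have h1 := (PolyhedralDivisor.nonneg_add_floor_iff z hk _).1 (hbz z) 0 (by
        rw [hD]
        intro i
        simp [hz i])
      rw [map_zero, add_zero, Int.cast_nonneg_iff] at h1
      rw [hFord, ordAt_pow]
      simp only [hz, mul_zero, Finset.sum_const_zero]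
      positivity
  refine IsIntegral.of_pow hn ?_
  rw [single_pow]
  exact isIntegral_algebraMap (x := (⟨_, hbn⟩ : A))

variable [Module.Free ℤ N]

/-- If the cone contains `v` and `-v`, every `m i` vanishes on `v`, hence so does all of `M`, and `v
= 0`. -/
theorem isPointedPolyhedralCone_dualOfWeights (hm : Submodule.span ℤ (Set.range m) = ⊤) :
    IsPointedPolyhedralCone (dualOfWeights m) := by
  refine ⟨(PointedCone.DualFG.dual_of_fg _ (Submodule.fg_span (Set.finite_range _))).fg, ?_⟩
  intro v hv hv0 hv'
  refine hv0 ((Module.forall_dual_apply_eq_zero_iff ℚ v).1 fun u => ?_)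
  obtain ⟨k, hk, m', hm'⟩ := exists_pos_smul_eq_toDualRat u
  have h0 : ∀ i, toDualRat (m i) v = 0 := fun i => le_antisymm
    (by simpa using mem_dualOfWeights.1 hv' i) (mem_dualOfWeights.1 hv i)
  have h1 : ∀ x ∈ Submodule.span ℤ (Set.range m), toDualRat x v = 0 := by
    intro x hx
    induction hx using Submodule.span_induction with
    | mem x hx =>
      obtain ⟨i, rfl⟩ := hx
      exact h0 i
    | zero => simp
    | add x y _ _ hx hy => rw [map_add, LinearMap.add_apply, hx, hy, add_zero]
    | smul c x _ hx => rw [map_smul, LinearMap.smul_apply, hx, smul_zero]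
  replace h1 := h1 m' (hm ▸ Submodule.mem_top)
  rw [← hm', LinearMap.smul_apply, smul_eq_mul] at h1
  have h2 : (k : ℚ) ≠ 0 := by exact_mod_cast hk.ne'
  exact (mul_eq_zero.1 h1).resolve_left h2

theorem hasFullFractionField_adjoin (hf : ∀ i, f i ≠ 0)
    (hm : Submodule.span ℤ (Set.range m) = ⊤) :
    HasFullFractionField (Algebra.adjoin A₀ (Set.range fun i => single (m i) (f i))) := by
  refine hasFullFractionField_of_closure_eq_top _ (top_le_iff.1 ?_)
  have h : AddSubgroup.closure (Set.range m) = ⊤ := by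
    rw [← Submodule.span_int_eq_addSubgroupClosure, hm, Submodule.top_toAddSubgroup]
  rw [← h]
  refine AddSubgroup.closure_mono ?_
  rintro _ ⟨i, rfl⟩
  exact gradedPiece_ne_bot (hf i) (Algebra.subset_adjoin ⟨i, rfl⟩)

/-- The normalization of the algebra generated by the `f_i χ^{m_i}` is the algebra of sections
of `𝔇[f]`. -/
theorem normalizationIn_adjoin_eq (hf : ∀ i, f i ≠ 0)
    (hm : Submodule.span ℤ (Set.range m) = ⊤) {D : PolyhedralDivisor A₀ (dualOfWeights m)}
    (hD : ∀ z, D.coeff z = generatorPolyhedron f m z) :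
    normalizationIn (Algebra.adjoin A₀ (Set.range fun i => single (m i) (f i))) =
      imageInFractionField (D.sectionAlgebra K) := by
  let L := FractionRing (AddMonoidAlgebra K (DualLattice N))
  have hσ := isPointedPolyhedralCone_dualOfWeights hm
  have hfull : IsFractionRing (D.sectionAlgebra K) L := D.hasFullFractionField_sectionAlgebra hσ
  have hic := D.isIntegrallyClosed_sectionAlgebra (K := K) hσ
  have hAB := adjoin_le_sectionAlgebra hf hD
  ext x
  constructor
  · intro hx
    have hx' : IsIntegral (Algebra.adjoin A₀ (Set.range fun i => single (m i) (f i))) x := hx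
    have hxB : IsIntegral (D.sectionAlgebra K) x := by
      have := hx'.map_of_comp_eq (Subalgebra.inclusion hAB).toRingHom (RingHom.id L) rfl
      exact this
    obtain ⟨y, rfl⟩ := (isIntegrallyClosed_iff L).1 hic hxB
    exact ⟨y, y.2, rfl⟩
  · rintro ⟨y, hy, rfl⟩
    have hyint : IsIntegral (Algebra.adjoin A₀ (Set.range fun i => single (m i) (f i))) y := by
      rw [← sum_coeff_single y]
      exact IsIntegral.sum _ fun k _ =>
        isIntegral_single_of_mem_sectionAlgebra hf hD (D.isGradedSubalgebra_sectionAlgebra y hy k)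
    exact hyint.algebraMap (B := L)

end Generators

/-! ### Existence of the divisor and the main theorem. -/

section Main

open AddMonoidAlgebra

variable {A₀ : Type*} [CommRing A₀] [IsDedekindDomain A₀]
  {K : Type*} [Field K] [Algebra A₀ K] [IsFractionRing A₀ K]
  {N : Type*} [AddCommGroup N] [Module.Free ℤ N] [Module.Finite ℤ N]

/-- A normal noetherian graded subalgebra of `K[M]` with the fraction field of `K[M]` is the
algebra of sections of a polyhedral divisor. -/
theorem exists_eq_sectionAlgebra {σ : PointedCone ℚ (RatSpace N)} (hσ : σ.FG)
    {A : Subalgebra A₀ (AddMonoidAlgebra K (DualLattice N))} (hA : IsGradedSubalgebra A)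
    (h0 : gradedPiece A 0 = 1) (hw : weightCone A = dualCone σ) [IsIntegrallyClosed A]
    [IsNoetherianRing A] (hfull : HasFullFractionField A) :
    ∃ D : PolyhedralDivisor A₀ σ, A = D.sectionAlgebra K := by
  obtain ⟨r, f, m, hf, -, rfl⟩ := exists_adjoin_eq_of_isNoetherianRing hA h0
  have hm := span_eq_top_of_hasFullFractionField hfull
  obtain rfl : σ = dualOfWeights m := by
    rw [weightCone_adjoin hf] at hw
    rw [dualOfWeights, hw]
    exact (PointedCone.FG.dual_id_dual_eval hσ).symm
  obtain ⟨D, hD⟩ := exists_polyhedralDivisor_coeff_eq hf (generatorPolyhedron_nonempty hf h0)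
  refine ⟨D, le_antisymm (adjoin_le_sectionAlgebra hf hD) fun a ha => ?_⟩
  let L := FractionRing (AddMonoidAlgebra K (DualLattice N))
  have : IsFractionRing
    (Algebra.adjoin A₀ (Set.range fun i => single (m i) (f i))) L := hfull
  have hmem : algebraMap (AddMonoidAlgebra K (DualLattice N)) L a ∈
      imageInFractionField (D.sectionAlgebra K) := ⟨a, ha, rfl⟩
  rw [← normalizationIn_adjoin_eq hf hm hD] at hmem
  obtain ⟨y, hy⟩ := (isIntegrallyClosed_iff L).1 ‹_› hmem
  have : (y : AddMonoidAlgebra K (DualLattice N)) = a :=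
    IsFractionRing.injective (AddMonoidAlgebra K (DualLattice N)) L hy
  exact this ▸ y.2

end Main

theorem mainTheorem2 {A₀ : Type*} [CommRing A₀] [IsDedekindDomain A₀]
    {K₀ : Type*} [Field K₀] [Algebra A₀ K₀] [IsFractionRing A₀ K₀]
    {N : Type*} [AddCommGroup N] [Module.Free ℤ N] [Module.Finite ℤ N] :
    (∀ σ : PointedCone ℚ (RatSpace N), IsPointedPolyhedralCone σ →
      (∀ D : PolyhedralDivisor A₀ σ,
        IsIntegrallyClosed (D.sectionAlgebra K₀) ∧
        IsNoetherianRing (D.sectionAlgebra K₀) ∧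
        HasFullFractionField (D.sectionAlgebra K₀)) ∧
      (∀ A : Subalgebra A₀ (AddMonoidAlgebra K₀ (DualLattice N)),
        IsGradedSubalgebra A → gradedPiece A 0 = 1 → weightCone A = dualCone σ →
        IsIntegrallyClosed A → IsNoetherianRing A → HasFullFractionField A →
        ∃! D : PolyhedralDivisor A₀ σ, A = D.sectionAlgebra K₀)) ∧
    (∀ (r : ℕ) (f : Fin r → K₀) (m : Fin r → DualLattice N),
      (∀ i, f i ≠ 0) → (∀ i, m i ≠ 0) → Submodule.span ℤ (Set.range m) = ⊤ →
      IsPointedPolyhedralCone (dualOfWeights m) ∧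
      dualCone (dualOfWeights m) = PointedCone.hull ℚ (Set.range fun i => toDualRat (m i)) ∧
      HasFullFractionField
        (Algebra.adjoin A₀ (Set.range fun i => AddMonoidAlgebra.single (m i) (f i))) ∧
      ((∀ z : IsDedekindDomain.HeightOneSpectrum A₀, (generatorPolyhedron f m z).Nonempty) →
        ∃ D : PolyhedralDivisor A₀ (dualOfWeights m),
          (∀ z, D.coeff z = generatorPolyhedron f m z) ∧
          normalizationIn
              (Algebra.adjoin A₀ (Set.range fun i => AddMonoidAlgebra.single (m i) (f i))) =
            imageInFractionField (D.sectionAlgebra K₀))) := by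
  refine ⟨fun σ hσ => ⟨fun D => ⟨D.isIntegrallyClosed_sectionAlgebra hσ,
    D.isNoetherianRing_sectionAlgebra hσ.1, D.hasFullFractionField_sectionAlgebra hσ⟩, ?_⟩, ?_⟩
  · intro A hA h0 hw hic hnoeth hfull
    obtain ⟨D, hD⟩ := exists_eq_sectionAlgebra hσ.1 hA h0 hw hfull
    exact ⟨D, hD, fun D' hD' =>
      PolyhedralDivisor.eq_of_sectionAlgebra_eq hσ.1 (hD'.symm.trans hD)⟩
  · intro r f m hf _ hm
    refine ⟨isPointedPolyhedralCone_dualOfWeights hm, dualCone_dualOfWeights,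
      hasFullFractionField_adjoin hf hm, fun hne => ?_⟩
    obtain ⟨D, hD⟩ := exists_polyhedralDivisor_coeff_eq hf hne
    exact ⟨D, hD, normalizationIn_adjoin_eq hf hm hD⟩
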